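/- Let $I=(0,1)$, let $v_1,v_2\in\mathbb R^3$ be unit vectors, let $0<R<\sqrt{(1-v_1\cdot v_2)/2}$, and for $j\in\{1,2\}$ let $$S_j=\{w\in\mathbb R^3:\ |w|=1,\ |\pi_{v_j^\perp}(w)|=R,\ w\cdot v_j>0\},\qquad K=S_1\cup S_2,$$ where $\pi_{v_j^\perp}$ is the orthogonal projection onto the orthogonal complement of $v_j$, and let $co(K)$ denote the convex hull of $K$. Let $\alpha>0$, let $\lambda_n>0$ with $\lambda_n\to0$, and put $N_n=\lfloor 1/\lambda_n\rfloor$. For $v=(v^0,\dots,v^{N_n})$ with $v^i\in K$ for all $i$ and $v^0\cdot v^1=v^{N_n-1}\cdot v^{N_n}$ (an admissible spin field), set $$E_n(v)=\lambda_n\sum_{i=0}^{N_n-2}\left[-\alpha\, v^i\cdot v^{i+1}+v^i\cdot v^{i+2}\right].$$ For $u\in L^\infty(I;\mathbb R^3)$ let $E_n(u)$ be the energy $E_n(v)$ of the admissible spin field $v$ such that $u(t)=v^i$ for a.e. $t\in I\cap\lambda_n[i,i+1)$ and every $i\in\{0,\dots,N_n\}$, and let $E_n(u)=+\infty$ if there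 is no such $v$. (If $1/\lambda_n$ is an integer, then $v^{N_n}$ is not determined by $u$, and the infimum over its possible values is taken.) For $z\in co(K)$ define $$f_{hom}(z)=\lim_{\rho\to0^+}\lim_{k\to+\infty}\frac1k\inf\left\{\sum_{i=1}^{k-2}\left[-\alpha\, u^i\cdot u^{i+1}+u^i\cdot u^{i+2}\right]\ :\ u\colon\mathbb Z\to K,\ \frac1{k-1}\sum_{i=1}^{k-1}u^i\in\overline{B(z,\rho)}\right\}.$$ Then both limits exist and are finite for every $z\in co(K)$, the function $f_{hom}\circ u$ is integrable on $I$ for every $u\in L^\infty(I;co(K))$, and $E_n$ $\Gamma$-converges, with respect to the weak-star convergence of $L^\infty(I;\mathbb R^3)$, to $$E(u)=\begin{cases}\displaystyle\int_I f_{hom}(u(t))\,dt&\text{if }u\in L^\infty(I;co(K)),\\ +\infty&\text{otherwise.}\end{cases}$$ That is, for every $u\in L^\infty(I;\mathbb R^3)$: (i) $E(u)\le\liminf_n E_n(u_n)$ for every sequence $u_n\rightharpoonup^* u$ in $L^\infty(I;\mathbb R^3)$; (ii) there is a sequence $u_n\rightharpoonup^* u$ in $L^\infty(I;\mathbb R^3)$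 with $\limsup_n E_n(u_n)\le E(u)$. -/

import Mathlib

open MeasureTheory Filter Topology Set

noncomputable section

namespace SpinChain

/-- The Euclidean space `ℝ³`. -/
abbrev E3 := EuclideanSpace ℝ (Fin 3)

/-- Lebesgue measure on the interval `I = (0, 1)`. -/
abbrev muI : Measure ℝ := volume.restrict (Ioo (0 : ℝ) 1)

/-- The space `L^∞(I; ℝ³)`. -/
abbrev Linf := Lp E3 ⊤ muI

/-- The circumference of radius `R` on the unit sphere identified by the unit vector `v`:
unit vectors `w` with `|π_{v^⊥}(w)| = R` and `⟨w, v⟩ > 0`. -/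
def circumference (v : E3) (R : ℝ) : Set E3 :=
  {w | ‖w‖ = 1 ∧ ‖((Submodule.span ℝ {v})ᗮ).starProjection w‖ = R ∧ 0 < inner ℝ w v}

/-- The indices `i ∈ ℤ` of the lattice of spacing `lam`, that is `lam * i ∈ [0, 1]`
(see `mem_latticeIdx`). -/
def latticeIdx (lam : ℝ) : Finset ℤ := Finset.Icc 0 ⌊1 / lam⌋

theorem mem_latticeIdx {lam : ℝ} (h : 0 < lam) (i : ℤ) :
    i ∈ latticeIdx lam ↔ lam * (i : ℝ) ∈ Icc (0 : ℝ) 1 := by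
  rw [latticeIdx, Finset.mem_Icc, Int.le_floor, le_div_iff₀ h, mem_Icc, mul_comm lam]
  refine and_congr_left fun _ => ?_
  rw [mul_nonneg_iff_of_pos_right h]
  exact_mod_cast Iff.rfl

/-- The indices over which the bulk energy is summed: the lattice indices without the
last two. -/
def bulkIdx (lam : ℝ) : Finset ℤ := latticeIdx lam \ {⌊1 / lam⌋ - 1, ⌊1 / lam⌋}

/-- Lattice spin fields with values in `K` that satisfy the joint boundary condition
`v⁰ · v¹ = v^{N-1} · v^N`, `N = ⌊1/lam⌋`. Only the values at the lattice indices matter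
(as soon as `lam ≤ 1`, so that `N ≥ 1`). -/
def IsAdmissible (K : Set E3) (lam : ℝ) (v : ℤ → E3) : Prop :=
  (∀ i ∈ latticeIdx lam, v i ∈ K) ∧
    inner ℝ (v 0) (v 1) = inner ℝ (v (⌊1 / lam⌋ - 1)) (v ⌊1 / lam⌋)

/-- The piecewise constant function with value `v i` on `lam * [i, i + 1)`. -/
def pcExtension (lam : ℝ) (v : ℤ → E3) (t : ℝ) : E3 := v ⌊t / lam⌋

/-- The bulk energy of a lattice spin field. -/
def latticeEnergy (α lam : ℝ) (v : ℤ → E3) : ℝ :=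
  lam * ∑ i ∈ bulkIdx lam, (-α * inner ℝ (v i) (v (i + 1)) + inner ℝ (v i) (v (i + 2)))

/-- The bulk energy on `L^∞(I; ℝ³)`: the energy of the admissible lattice spin field
represented by `u`, and `+∞` if there is none. The lattice field is determined by `u`
except, when `1 / lam` is an integer, for its value at the end point `1 ∉ I`;
the infimum is over that value. -/
def bulkEnergy (K : Set E3) (α lam : ℝ) (u : Linf) : EReal :=
  ⨅ v ∈ {v : ℤ → E3 | IsAdmissible K lam v ∧ u =ᵐ[muI] pcExtension lam v},
    ((latticeEnergy α lam v : ℝ) : EReal)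

/-- The average of `u` over a finite set of indices. -/
def discreteAverage (u : ℤ → E3) (s : Finset ℤ) : E3 := (s.card : ℝ)⁻¹ • ∑ i ∈ s, u i

/-- The minimum problem of the homogenization formula on the discrete cell `ℤ ∩ (0, k)`,
divided by `k`; it is `+∞` if there is no competitor. -/
def cellInf (K : Set E3) (α : ℝ) (z : E3) (ρ : ℝ) (k : ℕ) : EReal :=
  ⨅ u ∈ {u : ℤ → E3 | (∀ i, u i ∈ K) ∧
      discreteAverage u (Finset.Ioo 0 (k : ℤ)) ∈ Metric.closedBall z ρ},
    (((1 / (k : ℝ)) * ∑ i ∈ Finset.Icc (1 : ℤ) ((k : ℤ) - 2),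
      (-α * inner ℝ (u i) (u (i + 1)) + inner ℝ (u i) (u (i + 2))) : ℝ) : EReal)

/-- The homogenized energy density `lim_{ρ → 0⁺} lim_{k → ∞}` of the cell problems. -/
def fHom (K : Set E3) (α : ℝ) (z : E3) : ℝ :=
  (limUnder (𝓝[>] (0 : ℝ)) fun ρ => limUnder atTop fun k => cellInf K α z ρ k).toReal

/-- At `z`, both limits in the homogenization formula exist and are finite, and the value of
the iterated limit is `fHom K α z`. -/
def HomFormulaHolds (K : Set E3) (α : ℝ) (z : E3) : Prop :=
  ∃ g : ℝ → ℝ,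
    (∀ ρ > 0, Tendsto (fun k => cellInf K α z ρ k) atTop (𝓝 ((g ρ : ℝ) : EReal))) ∧
      Tendsto g (𝓝[>] 0) (𝓝 (fHom K α z))

open Classical in
/-- The limit functional: `∫_I fHom(u(t)) dt` on `L^∞(I; co K)`, and `+∞` elsewhere. -/
def limitEnergy (K : Set E3) (α : ℝ) (u : Linf) : EReal :=
  if ∀ᵐ t ∂muI, u t ∈ convexHull ℝ K then ((∫ t, fHom K α (u t) ∂muI : ℝ) : EReal) else ⊤

/-- Weak-star convergence in `L^∞(I; ℝ³)`, the dual of `L¹(I; ℝ³)`. -/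
def WeakStarTendsto (us : ℕ → Linf) (u : Linf) : Prop :=
  ∀ g : ℝ → E3, Integrable g muI →
    Tendsto (fun n => ∫ t, inner ℝ (us n t) (g t) ∂muI) atTop (𝓝 (∫ t, inner ℝ (u t) (g t) ∂muI))

/-- `Γ`-convergence of functionals on `L^∞(I; ℝ³)` with respect to weak-star convergence:
the liminf inequality and the existence of recovery sequences. -/
structure GammaConverges (F : ℕ → Linf → EReal) (G : Linf → EReal) : Prop where
  liminf_le : ∀ (u : Linf) (us : ℕ → Linf), WeakStarTendsto us u →
    G u ≤ liminf (fun n => F n (us n)) atTop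
  recovery : ∀ u : Linf, ∃ us : ℕ → Linf, WeakStarTendsto us u ∧
    limsup (fun n => F n (us n)) atTop ≤ G u

end SpinChain

end

/-! Record each chain of `n` spins by the pair (total spin, total energy) in `ℝ³ × ℝ`, and let `T n`
be the set of these pairs. The interaction reaches only two sites ahead, so concatenating two chains
changes the energy by a bounded amount. Hence `T m + T n` lies in a bounded neighbourhood of `T (m +
n)`, and a set-valued Fekete argument shows that `n⁻¹ • T n` has a limit set `A = asymptoticSet T`
that is compact and convex. The cell problem at radius `ρ` converges to the least energy in `A` over
the ball of radius `ρ` about `z`, and letting `ρ → 0` identifies `fHom` with the lower boundary of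
`A` (`tendsto_cellInf`, `tendsto_cellMin`).

Both halves of the Γ-limit are then read off from `A`. Cut `I` into `M` equal cells. For the lower
bound, the lattice chain on each cell, rescaled, converges along an ultrafilter to a point of `A`,
whose first component is the mean of `u` by weak-star convergence (`cellMean_mem_and_sum_fHom_le`).
Lebesgue differentiation and lower semicontinuity then allow `M → ∞`. For the upper bound, convexity
of `A` is Jensen's inequality for the cell means. Chains realizing these means with nearly optimal
energy are concatenated, the last two spins are changed to meet the boundary condition, and a
diagonal choice of `M` concludes (`eventually_exists_approx`, `exists_recovery`). The set `K` enters
through its compactness and the bound `‖w‖ ≤ 1`. -/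

noncomputable section

namespace SpinChain

/-! ### Almost additive sequences of sets and their limit set -/

section AlmostAdditive

variable {V : Type*} [NormedAddCommGroup V]

/-- A sequence of nonempty sets of linearly growing size that is superadditive up to a
bounded error. -/
structure IsAlmostAdditive (T : ℕ → Set V) (C D : ℝ) : Prop where
  nonempty : ∀ n, (T n).Nonempty
  norm_le : ∀ n, ∀ x ∈ T n, ‖x‖ ≤ C * n
  add : ∀ m n, ∀ x ∈ T m, ∀ y ∈ T n, ∃ z ∈ T (m + n), ‖z - (x + y)‖ ≤ D

variable {T : ℕ → Set V} {C D : ℝ}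

theorem IsAlmostAdditive.nonneg_left (h : IsAlmostAdditive T C D) : 0 ≤ C := by
  obtain ⟨x, hx⟩ := h.nonempty 1
  simpa using (norm_nonneg x).trans (h.norm_le 1 x hx)

theorem IsAlmostAdditive.nonneg_right (h : IsAlmostAdditive T C D) : 0 ≤ D := by
  obtain ⟨x, hx⟩ := h.nonempty 1
  obtain ⟨z, -, hz⟩ := h.add 1 1 x hx x hx
  exact (norm_nonneg _).trans hz

variable [NormedSpace ℝ V]

/-- The limit of the rescaled sets `n⁻¹ • T n`. -/
def asymptoticSet (T : ℕ → Set V) : Set V :=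
  {w | ∀ ε > 0, ∀ᶠ n : ℕ in atTop, ∃ x ∈ T n, ‖x - (n : ℝ) • w‖ ≤ ε * n}

theorem IsAlmostAdditive.exists_nsmul (h : IsAlmostAdditive T C D) {k : ℕ} {x : V}
    (hx : x ∈ T k) (p : ℕ) : ∃ y ∈ T (p * k), ‖y - (p : ℝ) • x‖ ≤ p * D := by
  induction p with
  | zero =>
    obtain ⟨y, hy⟩ := h.nonempty 0
    refine ⟨y, by simpa using hy, ?_⟩
    simpa using h.norm_le 0 y hy
  | succ p ih =>
    obtain ⟨y, hy, hyx⟩ := ih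
    obtain ⟨z, hz, hzy⟩ := h.add _ _ y hy x hx
    refine ⟨z, by rwa [Nat.succ_mul], ?_⟩
    have e : z - ((p + 1 : ℕ) : ℝ) • x = (z - (y + x)) + (y - (p : ℝ) • x) := by
      push_cast; module
    rw [e]
    refine (norm_add_le _ _).trans ?_
    push_cast
    linarith

/-- Divide `n` by `k`: repeat `x` on the `n / k` full blocks and fill the remainder with any element
of `T (n % k)`. The filler and the fractional part of `n / k` cost at most `C * k` each. -/
theorem IsAlmostAdditive.exists_near_smul (h : IsAlmostAdditive T C D) {k : ℕ} (hk : 0 < k)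
    {x : V} (hx : x ∈ T k) (n : ℕ) :
    ∃ y ∈ T n, ‖y - ((n : ℝ) / k) • x‖ ≤ (n : ℝ) / k * D + D + 2 * C * k := by
  have hC := h.nonneg_left
  have hD := h.nonneg_right
  have hk' : (0 : ℝ) < k := by exact_mod_cast hk
  obtain ⟨y, hy, hyx⟩ := h.exists_nsmul hx (n / k)
  obtain ⟨r, hr⟩ := h.nonempty (n % k)
  obtain ⟨z, hz, hzy⟩ := h.add _ _ y hy r hr
  have hn : n / k * k + n % k = n := Nat.div_add_mod' n k
  have hn' : ((n / k : ℕ) : ℝ) * k + ((n % k : ℕ) : ℝ) = n := by exact_mod_cast hn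
  have hmod : ((n % k : ℕ) : ℝ) ≤ k := by exact_mod_cast (Nat.mod_lt n hk).le
  have hdiv : ((n / k : ℕ) : ℝ) ≤ (n : ℝ) / k := Nat.cast_div_le
  refine ⟨z, hn ▸ hz, ?_⟩
  have e : z - ((n : ℝ) / k) • x = (z - (y + r)) + (y - ((n / k : ℕ) : ℝ) • x) + r
      - (((n % k : ℕ) : ℝ) / k) • x := by
    have : (n : ℝ) / k = ((n / k : ℕ) : ℝ) + ((n % k : ℕ) : ℝ) / k := by
      rw [← hn']; field_simp
    rw [this]; module
  have h1 : ‖r‖ ≤ C * k := (h.norm_le _ r hr).trans (by gcongr)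
  have h2 : ‖(((n % k : ℕ) : ℝ) / k) • x‖ ≤ C * k := by
    rw [norm_smul, Real.norm_of_nonneg (by positivity)]
    calc ((n % k : ℕ) : ℝ) / k * ‖x‖ ≤ 1 * (C * k) := by
          gcongr
          · exact (div_le_one hk').2 hmod
          · exact h.norm_le _ x hx
      _ = C * k := one_mul _
  have h3 : ((n / k : ℕ) : ℝ) * D ≤ (n : ℝ) / k * D := by gcongr
  rw [e]
  have := norm_sub_le ((z - (y + r)) + (y - ((n / k : ℕ) : ℝ) • x) + r)
    ((((n % k : ℕ) : ℝ) / k) • x)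
  have := norm_add₃_le (a := z - (y + r)) (b := y - ((n / k : ℕ) : ℝ) • x) (c := r)
  linarith

/-- A single good `k`, large enough that the junction cost per site `D / k` is at most `ε / 2`,
serves every `n` by repetition. This upgrades infinitely many `n` to all `n`. -/
theorem IsAlmostAdditive.exists_near_of_frequently (h : IsAlmostAdditive T C D) {w : V}
    (hw : ∀ ε > 0, ∃ᶠ n : ℕ in atTop, ∃ x ∈ T n, ‖x - (n : ℝ) • w‖ ≤ ε * n)
    {ε : ℝ} (hε : 0 < ε) : ∃ B, ∀ n, ∃ y ∈ T n, ‖y - (n : ℝ) • w‖ ≤ ε * n + B := by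
  have hlarge : ∀ᶠ n : ℕ in atTop, 0 < n ∧ D / n ≤ ε / 2 :=
    (eventually_gt_atTop 0).and
      ((tendsto_const_div_atTop_nhds_zero_nat D).eventually_le_const (by positivity))
  obtain ⟨k, ⟨x, hx, hxw⟩, hk, hDk⟩ := ((hw (ε / 2) (by positivity)).and_eventually hlarge).exists
  have hk' : (0 : ℝ) < k := by exact_mod_cast hk
  refine ⟨D + 2 * C * k, fun n => ?_⟩
  obtain ⟨y, hy, hyx⟩ := h.exists_near_smul hk hx n
  refine ⟨y, hy, ?_⟩
  have e : y - (n : ℝ) • w = (y - ((n : ℝ) / k) • x) + ((n : ℝ) / k) • (x - (k : ℝ) • w) := by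
    rw [smul_sub, smul_smul, div_mul_cancel₀ _ hk'.ne']; abel
  have h1 : ‖((n : ℝ) / k) • (x - (k : ℝ) • w)‖ ≤ ε / 2 * n := by
    rw [norm_smul, Real.norm_of_nonneg (by positivity)]
    calc (n : ℝ) / k * ‖x - (k : ℝ) • w‖ ≤ (n : ℝ) / k * (ε / 2 * k) := by gcongr
      _ = ε / 2 * n := by field_simp
  have h2 : (n : ℝ) / k * D ≤ ε / 2 * n := by
    calc (n : ℝ) / k * D = n * (D / k) := by ring
      _ ≤ n * (ε / 2) := by gcongr
      _ = ε / 2 * n := mul_comm _ _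
  rw [e]
  have := norm_add_le (y - ((n : ℝ) / k) • x) (((n : ℝ) / k) • (x - (k : ℝ) • w))
  linarith

/-- Spend `⌊a * n⌋₊` sites on `w₁` and the others on `w₂`; rounding costs at most `‖w₁‖ + ‖w₂‖`.
Assuming only frequent approximability makes this one lemma yield both convexity and, with `a = 1`,
the fact that subsequential limits are limits. -/
theorem IsAlmostAdditive.combo_mem_asymptoticSet (h : IsAlmostAdditive T C D) {w₁ w₂ : V}
    (hw₁ : ∀ ε > 0, ∃ᶠ n : ℕ in atTop, ∃ x ∈ T n, ‖x - (n : ℝ) • w₁‖ ≤ ε * n)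
    (hw₂ : ∀ ε > 0, ∃ᶠ n : ℕ in atTop, ∃ x ∈ T n, ‖x - (n : ℝ) • w₂‖ ≤ ε * n)
    {a b : ℝ} (ha : 0 ≤ a) (hb : 0 ≤ b) (hab : a + b = 1) :
    a • w₁ + b • w₂ ∈ asymptoticSet T := by
  intro ε hε
  obtain ⟨B₁, hB₁⟩ := h.exists_near_of_frequently hw₁ (half_pos hε)
  obtain ⟨B₂, hB₂⟩ := h.exists_near_of_frequently hw₂ (half_pos hε)
  filter_upwards [(tendsto_const_div_atTop_nhds_zero_nat
    (D + B₁ + B₂ + ‖w₁‖ + ‖w₂‖)).eventually_le_const (half_pos hε), eventually_gt_atTop 0]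
    with n hn hn0
  have hn0' : (0 : ℝ) < n := by exact_mod_cast hn0
  rw [div_le_iff₀ hn0'] at hn
  have han : 0 ≤ a * n := by positivity
  have hle : ⌊a * (n : ℝ)⌋₊ ≤ n := Nat.floor_le_of_le (by nlinarith)
  obtain ⟨m, hm⟩ := Nat.exists_eq_add_of_le hle
  have hm' : (n : ℝ) = (⌊a * (n : ℝ)⌋₊ : ℝ) + m := by exact_mod_cast hm
  have hf₁ := Nat.floor_le han
  have hf₂ := Nat.lt_floor_add_one (a * (n : ℝ))
  generalize ⌊a * (n : ℝ)⌋₊ = p at *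
  obtain ⟨y₁, hy₁, hyw₁⟩ := hB₁ p
  obtain ⟨y₂, hy₂, hyw₂⟩ := hB₂ m
  obtain ⟨z, hz, hzy⟩ := h.add _ _ y₁ hy₁ y₂ hy₂
  refine ⟨z, hm ▸ hz, ?_⟩
  have hs : |(p : ℝ) - a * n| ≤ 1 := by rw [abs_le]; constructor <;> linarith
  have e : z - (n : ℝ) • (a • w₁ + b • w₂) = (z - (y₁ + y₂)) + (y₁ - (p : ℝ) • w₁)
      + (y₂ - (m : ℝ) • w₂) + ((p : ℝ) - a * n) • (w₁ - w₂) := by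
    have hm2 : (m : ℝ) = n - p := by linarith
    have hb2 : b = 1 - a := by linarith
    rw [hm2, hb2]; module
  have h4 : ‖((p : ℝ) - a * n) • (w₁ - w₂)‖ ≤ ‖w₁‖ + ‖w₂‖ := by
    rw [norm_smul]
    calc ‖(p : ℝ) - a * n‖ * ‖w₁ - w₂‖ ≤ 1 * (‖w₁‖ + ‖w₂‖) := by
          gcongr
          · exact hs
          · exact norm_sub_le _ _
      _ = _ := one_mul _
  rw [e]
  have h5 := norm_add_le ((z - (y₁ + y₂)) + (y₁ - (p : ℝ) • w₁) + (y₂ - (m : ℝ) • w₂))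
    (((p : ℝ) - a * n) • (w₁ - w₂))
  have h6 := norm_add₃_le (a := z - (y₁ + y₂)) (b := y₁ - (p : ℝ) • w₁) (c := y₂ - (m : ℝ) • w₂)
  have h7 : ε * n = ε / 2 * p + ε / 2 * m + ε / 2 * n := by rw [hm']; ring
  linarith

theorem frequently_of_mem_asymptoticSet {w : V} (hw : w ∈ asymptoticSet T) :
    ∀ ε > 0, ∃ᶠ n : ℕ in atTop, ∃ x ∈ T n, ‖x - (n : ℝ) • w‖ ≤ ε * n :=
  fun ε hε => (hw ε hε).frequently

theorem IsAlmostAdditive.convex_asymptoticSet (h : IsAlmostAdditive T C D) :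
    Convex ℝ (asymptoticSet T) := fun _ hx _ hy _ _ ha hb hab =>
  h.combo_mem_asymptoticSet (frequently_of_mem_asymptoticSet hx)
    (frequently_of_mem_asymptoticSet hy) ha hb hab

theorem IsAlmostAdditive.mem_asymptoticSet_of_frequently (h : IsAlmostAdditive T C D) {w : V}
    (hw : ∀ ε > 0, ∃ᶠ n : ℕ in atTop, ∃ x ∈ T n, ‖x - (n : ℝ) • w‖ ≤ ε * n) :
    w ∈ asymptoticSet T := by
  simpa using h.combo_mem_asymptoticSet hw hw zero_le_one le_rfl (add_zero 1)

/-- Limits of rescaled elements of `T (L i)` along any filter belong to the asymptotic set. -/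
theorem IsAlmostAdditive.mem_asymptoticSet_of_tendsto (h : IsAlmostAdditive T C D) {ι : Type*}
    {l : Filter ι} [l.NeBot] {L : ι → ℕ} (hL : Tendsto L l atTop) {x : ι → V}
    (hx : ∀ᶠ i in l, x i ∈ T (L i)) {w : V}
    (hw : Tendsto (fun i => (L i : ℝ)⁻¹ • x i) l (𝓝 w)) : w ∈ asymptoticSet T := by
  refine h.mem_asymptoticSet_of_frequently fun ε hε => hL.frequently (Eventually.frequently ?_)
  filter_upwards [hx, hw (Metric.closedBall_mem_nhds w hε), hL.eventually_gt_atTop 0]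
    with i hi hiw hi0
  have hi0' : (0 : ℝ) < L i := by exact_mod_cast hi0
  refine ⟨x i, hi, ?_⟩
  have e : x i - (L i : ℝ) • w = (L i : ℝ) • ((L i : ℝ)⁻¹ • x i - w) := by
    rw [smul_sub, smul_inv_smul₀ hi0'.ne']
  rw [e, norm_smul, Real.norm_of_nonneg hi0'.le, mul_comm ε]
  gcongr
  simpa [dist_eq_norm] using hiw

theorem isClosed_asymptoticSet : IsClosed (asymptoticSet T) := by
  refine isClosed_of_closure_subset fun w hw ε hε => ?_
  obtain ⟨w', hw', hd⟩ := Metric.mem_closure_iff.1 hw (ε / 2) (half_pos hε)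
  filter_upwards [hw' (ε / 2) (half_pos hε)] with n ⟨x, hx, hxw⟩
  refine ⟨x, hx, ?_⟩
  have e : x - (n : ℝ) • w = (x - (n : ℝ) • w') - (n : ℝ) • (w - w') := by module
  have h1 : ‖(n : ℝ) • (w - w')‖ ≤ ε / 2 * n := by
    rw [norm_smul, Real.norm_of_nonneg (by positivity), mul_comm, ← dist_eq_norm]
    gcongr
  rw [e]
  have := norm_sub_le (x - (n : ℝ) • w') ((n : ℝ) • (w - w'))
  linarith

theorem IsAlmostAdditive.norm_le_of_mem_asymptoticSet (h : IsAlmostAdditive T C D) {w : V}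
    (hw : w ∈ asymptoticSet T) : ‖w‖ ≤ C := by
  refine le_of_forall_pos_le_add fun ε hε => ?_
  obtain ⟨n, ⟨x, hx, hxw⟩, hn⟩ := ((hw ε hε).and (eventually_gt_atTop 0)).exists
  have hn' : (0 : ℝ) < n := by exact_mod_cast hn
  have h1 := h.norm_le n x hx
  have h2 : ‖(n : ℝ) • w‖ ≤ ‖x‖ + ‖x - (n : ℝ) • w‖ := by
    have := norm_sub_le x (x - (n : ℝ) • w)
    rwa [sub_sub_cancel] at this
  rw [norm_smul, Real.norm_of_nonneg hn'.le] at h2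
  nlinarith

theorem IsAlmostAdditive.isCompact_asymptoticSet [ProperSpace V] (h : IsAlmostAdditive T C D) :
    IsCompact (asymptoticSet T) :=
  (isCompact_closedBall (0 : V) C).of_isClosed_subset isClosed_asymptoticSet fun _ hw => by
    simpa using h.norm_le_of_mem_asymptoticSet hw

end AlmostAdditive

/-! ### Spin chains and their spin-energy sums -/

/-- The interaction energy of the site `i` with its two successors. -/
def chainEnergy (α : ℝ) (u : ℕ → E3) (i : ℕ) : ℝ :=
  -α * inner ℝ (u i) (u (i + 1)) + inner ℝ (u i) (u (i + 2))

/-- The pair of the total spin and the total energy of the first `n` sites. -/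
def chainSum (α : ℝ) (u : ℕ → E3) (n : ℕ) : E3 × ℝ :=
  ∑ i ∈ Finset.range n, (u i, chainEnergy α u i)

/-- The values of `chainSum` on the `K`-valued chains. -/
def chainSums (K : Set E3) (α : ℝ) (n : ℕ) : Set (E3 × ℝ) :=
  {x | ∃ u : ℕ → E3, (∀ i, u i ∈ K) ∧ chainSum α u n = x}

/-- The convex hull of a compact set in a finite-dimensional space is compact. -/
theorem isCompact_convexHull {V : Type*} [NormedAddCommGroup V] [NormedSpace ℝ V]
    [FiniteDimensional ℝ V] {s : Set V} (hs : IsCompact s) : IsCompact (convexHull ℝ s) := by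
  have e : convexHull ℝ s = ⋃ m ∈ Finset.range (Module.finrank ℝ V + 2),
      (fun p : (Fin m → ℝ) × (Fin m → V) => ∑ i, p.1 i • p.2 i) ''
        (stdSimplex ℝ (Fin m) ×ˢ Set.pi univ fun _ => s) := by
    refine Subset.antisymm (fun x hx => ?_) (iUnion₂_subset fun m _ => ?_)
    · obtain ⟨ι, hι, z, w, hz, hind, hw0, hw1, rfl⟩ := eq_pos_convex_span_of_mem_convexHull hx
      let e := Fintype.equivFin ι
      refine mem_iUnion₂.2 ⟨Fintype.card ι, ?_, (w ∘ e.symm, z ∘ e.symm), ⟨⟨?_, ?_⟩, ?_⟩, ?_⟩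
      · have := hind.card_le_finrank_succ
        have := Submodule.finrank_le (vectorSpan ℝ (range z))
        rw [Finset.mem_range]; omega
      · exact fun i => (hw0 _).le
      · simpa using (e.symm.sum_comp w).trans hw1
      · exact fun i _ => hz (mem_range_self _)
      · exact e.symm.sum_comp fun i => w i • z i
    · rintro _ ⟨p, ⟨⟨h0, h1⟩, hp⟩, rfl⟩
      exact (convex_convexHull ℝ s).sum_mem (fun i _ => h0 i) h1
        fun i _ => subset_convexHull ℝ s (hp i (mem_univ i))
  rw [e]
  refine Finset.isCompact_biUnion _ fun m _ => IsCompact.image ?_ (by fun_prop)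
  exact (isCompact_stdSimplex ℝ (Fin m)).prod (isCompact_univ_pi fun _ => hs)

variable {K : Set E3} {α : ℝ}

theorem chainSum_fst (u : ℕ → E3) (n : ℕ) :
    (chainSum α u n).1 = ∑ i ∈ Finset.range n, u i := by
  simp [chainSum, Prod.fst_sum]

theorem chainSum_snd (u : ℕ → E3) (n : ℕ) :
    (chainSum α u n).2 = ∑ i ∈ Finset.range n, chainEnergy α u i := by
  simp [chainSum, Prod.snd_sum]

theorem abs_chainEnergy_le (hα : 0 ≤ α) {u : ℕ → E3} (hu : ∀ i, ‖u i‖ ≤ 1) (i : ℕ) :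
    |chainEnergy α u i| ≤ α + 1 := by
  have key : ∀ a b, |inner ℝ (u a) (u b)| ≤ 1 := fun a b =>
    (abs_real_inner_le_norm _ _).trans (mul_le_one₀ (hu a) (norm_nonneg _) (hu b))
  have h1 := abs_le.1 (key i (i + 1))
  have h2 := abs_le.1 (key i (i + 2))
  rw [chainEnergy, abs_le]
  constructor <;> nlinarith

theorem norm_chainTerm_le (hα : 0 ≤ α) {u : ℕ → E3} (hu : ∀ i, ‖u i‖ ≤ 1) (i : ℕ) :
    ‖(u i, chainEnergy α u i)‖ ≤ α + 1 := by
  rw [Prod.norm_mk]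
  exact max_le ((hu i).trans (by linarith)) (abs_chainEnergy_le hα hu i)

theorem norm_chainSum_le (hα : 0 ≤ α) {u : ℕ → E3} (hu : ∀ i, ‖u i‖ ≤ 1) (n : ℕ) :
    ‖chainSum α u n‖ ≤ (α + 1) * n := by
  refine (norm_sum_le_of_le _ fun i _ => norm_chainTerm_le hα hu i).trans_eq ?_
  rw [Finset.sum_const, Finset.card_range, nsmul_eq_mul, mul_comm]

theorem chainSum_add (u : ℕ → E3) (m n : ℕ) :
    chainSum α u (m + n) = chainSum α u m + chainSum α (fun i => u (m + i)) n := by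
  simp only [chainSum, Finset.sum_range_add]
  rfl

theorem chainSum_mul (u : ℕ → E3) (M L : ℕ) :
    chainSum α u (M * L) = ∑ j ∈ Finset.range M, chainSum α (fun i => u (j * L + i)) L := by
  induction M with
  | zero => simp [chainSum]
  | succ M ih => rw [Nat.succ_mul, chainSum_add, ih, Finset.sum_range_succ]

/-- The effect of the sites behind the first `m` ones on `chainSum` is bounded. -/
theorem norm_chainSum_sub_le (hα : 0 ≤ α) {u v : ℕ → E3} (hu : ∀ i, ‖u i‖ ≤ 1)
    (hv : ∀ i, ‖v i‖ ≤ 1) {m : ℕ} (h : ∀ i < m, u i = v i) :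
    ‖chainSum α u m - chainSum α v m‖ ≤ 4 * (α + 1) := by
  have h1 : ∀ i, ‖(u i, chainEnergy α u i) - (v i, chainEnergy α v i)‖ ≤ 2 * (α + 1) :=
    fun i => (norm_sub_le _ _).trans (by
      linarith [norm_chainTerm_le hα hu i, norm_chainTerm_le hα hv i])
  rw [chainSum, chainSum, ← Finset.sum_sub_distrib]
  match m with
  | 0 => simp; positivity
  | 1 => simpa using (h1 0).trans (by linarith)
  | m + 2 =>
    -- The terms with `i < m` involve only sites below `m + 2`, where the chains agree; each of the
    -- last two terms contributes at most `2 * (α + 1)`.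
    rw [Finset.sum_range_succ, Finset.sum_range_succ, Finset.sum_eq_zero, zero_add]
    · exact (norm_add_le _ _).trans (by linarith [h1 m, h1 (m + 1)])
    · intro i hi
      have hi' := Finset.mem_range.1 hi
      simp [chainEnergy, h i (by omega), h (i + 1) (by omega), h (i + 2) (by omega)]

theorem isAlmostAdditive_chainSums (hα : 0 ≤ α) (hK : K.Nonempty) (hK1 : ∀ w ∈ K, ‖w‖ ≤ 1) :
    IsAlmostAdditive (chainSums K α) (α + 1) (4 * (α + 1)) where
  nonempty n := by
    obtain ⟨w, hw⟩ := hK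
    exact ⟨_, fun _ => w, fun _ => hw, rfl⟩
  norm_le := by
    rintro n _ ⟨u, hu, rfl⟩
    exact norm_chainSum_le hα (fun i => hK1 _ (hu i)) n
  add := by
    rintro m n _ ⟨u, hu, rfl⟩ _ ⟨v, hv, rfl⟩
    set w : ℕ → E3 := fun i => if i < m then u i else v (i - m) with hw
    have hwK : ∀ i, w i ∈ K := fun i => by
      simp only [hw]; split_ifs
      exacts [hu i, hv _]
    refine ⟨_, ⟨w, hwK, rfl⟩, ?_⟩
    have e : (fun i => w (m + i)) = v := by ext1 i; simp [hw]
    rw [chainSum_add, e, add_sub_add_right_eq_sub]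
    exact norm_chainSum_sub_le hα (fun i => hK1 _ (hwK i)) (fun i => hK1 _ (hu i))
      fun i hi => by simp [hw, hi]

theorem inv_smul_fst_mem_convexHull {n : ℕ} (hn : 0 < n) {x : E3 × ℝ}
    (hx : x ∈ chainSums K α n) : (n : ℝ)⁻¹ • x.1 ∈ convexHull ℝ K := by
  obtain ⟨u, hu, rfl⟩ := hx
  have hn' : (n : ℝ) ≠ 0 := by exact_mod_cast hn.ne'
  rw [chainSum_fst, Finset.smul_sum]
  refine (convex_convexHull ℝ K).sum_mem (fun _ _ => by positivity) ?_
    fun i _ => subset_convexHull ℝ K (hu i)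
  simp [hn']

theorem fst_mem_convexHull (hKc : IsCompact K) {w : E3 × ℝ}
    (hw : w ∈ asymptoticSet (chainSums K α)) : w.1 ∈ convexHull ℝ K := by
  have hcl : IsClosed (convexHull ℝ K) := (isCompact_convexHull hKc).isClosed
  rw [← hcl.closure_eq, Metric.mem_closure_iff]
  intro ε hε
  obtain ⟨n, ⟨x, hx, hxw⟩, hn⟩ := ((hw (ε / 2) (half_pos hε)).and (eventually_gt_atTop 0)).exists
  have hn' : (0 : ℝ) < n := by exact_mod_cast hn
  refine ⟨_, inv_smul_fst_mem_convexHull hn hx, ?_⟩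
  have e : w.1 - (n : ℝ)⁻¹ • x.1 = -((n : ℝ)⁻¹ • (x - (n : ℝ) • w).1) := by
    simp [smul_sub, inv_smul_smul₀ hn'.ne']
  rw [dist_eq_norm, e, norm_neg, norm_smul, Real.norm_of_nonneg (by positivity),
    inv_mul_lt_iff₀ hn']
  have := (norm_fst_le (x - (n : ℝ) • w)).trans hxw
  nlinarith

/-- Constant chains provide a point of the asymptotic set above each point of `K`, and the
projection of a convex set is convex. -/
theorem exists_mem_asymptoticSet (hα : 0 ≤ α) (hK1 : ∀ w ∈ K, ‖w‖ ≤ 1) {z : E3}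
    (hz : z ∈ convexHull ℝ K) : ∃ E, (z, E) ∈ asymptoticSet (chainSums K α) := by
  have hK : K.Nonempty := convexHull_nonempty_iff.1 ⟨z, hz⟩
  have hconv : Convex ℝ (LinearMap.fst ℝ E3 ℝ '' asymptoticSet (chainSums K α)) :=
    (isAlmostAdditive_chainSums hα hK hK1).convex_asymptoticSet.linear_image _
  have hsub : K ⊆ LinearMap.fst ℝ E3 ℝ '' asymptoticSet (chainSums K α) := fun w hw => by
    refine ⟨(w, -α * inner ℝ w w + inner ℝ w w), fun ε hε => Eventually.of_forall fun n => ?_, rfl⟩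
    refine ⟨_, ⟨fun _ => w, fun _ => hw, rfl⟩, ?_⟩
    simp only [chainSum, chainEnergy, Finset.sum_const, Finset.card_range, Nat.cast_smul_eq_nsmul,
      sub_self, norm_zero]
    positivity
  obtain ⟨⟨z', E⟩, h, rfl⟩ := convexHull_min hsub hconv hz
  exact ⟨E, h⟩

/-! ### Cell problems and the lower boundary of the asymptotic set -/

theorem sum_Icc_one_int {V : Type*} [AddCommMonoid V] (f : ℤ → V) (m : ℕ) :
    ∑ i ∈ Finset.Icc (1 : ℤ) m, f i = ∑ r ∈ Finset.range m, f (r + 1) := by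
  refine Finset.sum_bij' (fun i _ => (i - 1).toNat) (fun r _ => (r : ℤ) + 1) ?_ ?_ ?_ ?_ ?_
  · intro i hi; simp at hi ⊢; omega
  · intro i hi; simp at hi ⊢; omega
  · intro i hi; simp at hi ⊢; omega
  · intro i hi; simp
  · intro i hi; simp at hi ⊢; congr 1; omega

theorem discreteAverage_eq (u : ℤ → E3) (m : ℕ) :
    discreteAverage u (Finset.Ioo 0 ((m + 2 : ℕ) : ℤ)) =
      ((m + 1 : ℕ) : ℝ)⁻¹ • (chainSum α (fun i => u (i + 1)) (m + 1)).1 := by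
  have e : Finset.Ioo (0 : ℤ) ((m + 2 : ℕ) : ℤ) = Finset.Icc (1 : ℤ) ((m + 1 : ℕ) : ℤ) := by
    ext i; simp; omega
  rw [discreteAverage, e, sum_Icc_one_int, chainSum_fst, Int.card_Icc]
  congr 3
  omega

/-- For `k = m + 2` the cell problem averages `m + 1` spins but sums only `m` energies. The surplus
term of `chainSum` is what the `α + 1` in the next two lemmas pays for. -/
theorem cellSum_eq (u : ℤ → E3) (m : ℕ) :
    ∑ i ∈ Finset.Icc (1 : ℤ) (((m + 2 : ℕ) : ℤ) - 2),
      (-α * inner ℝ (u i) (u (i + 1)) + inner ℝ (u i) (u (i + 2))) =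
    (chainSum α (fun i => u (i + 1)) (m + 1)).2 - chainEnergy α (fun i => u (i + 1)) m := by
  have e : ((m + 2 : ℕ) : ℤ) - 2 = (m : ℤ) := by push_cast; ring
  rw [e, sum_Icc_one_int, chainSum_snd, Finset.sum_range_succ, add_sub_cancel_right]
  refine Finset.sum_congr rfl fun i _ => ?_
  simp only [chainEnergy]
  push_cast
  ring_nf

theorem cellInf_le (hα : 0 ≤ α) (hK1 : ∀ w ∈ K, ‖w‖ ≤ 1) {z : E3} {ρ : ℝ} {m : ℕ} {x : E3 × ℝ}
    (hx : x ∈ chainSums K α (m + 1)) (hxz : ‖((m + 1 : ℕ) : ℝ)⁻¹ • x.1 - z‖ ≤ ρ) :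
    cellInf K α z ρ (m + 2) ≤ (((x.2 + (α + 1)) / ((m + 2 : ℕ) : ℝ) : ℝ) : EReal) := by
  obtain ⟨u, hu, rfl⟩ := hx
  have hmem : (fun i : ℤ => u (i - 1).toNat) ∈ {u : ℤ → E3 | (∀ i, u i ∈ K) ∧
      discreteAverage u (Finset.Ioo 0 ((m + 2 : ℕ) : ℤ)) ∈ Metric.closedBall z ρ} := by
    refine ⟨fun i => hu _, ?_⟩
    rw [discreteAverage_eq (α := α)]
    simpa [dist_eq_norm] using hxz
  refine (iInf₂_le _ hmem).trans ?_
  rw [EReal.coe_le_coe_iff, cellSum_eq, one_div, div_eq_inv_mul]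
  have e : (fun i : ℕ => u (((i : ℤ) + 1) - 1).toNat) = u := by ext1 i; simp
  rw [e]
  have := abs_le.1 (abs_chainEnergy_le hα (fun i => hK1 _ (hu i)) m)
  gcongr
  linarith

theorem exists_of_cellInf_lt (hα : 0 ≤ α) (hK1 : ∀ w ∈ K, ‖w‖ ≤ 1) {z : E3} {ρ c : ℝ} {m : ℕ}
    (h : cellInf K α z ρ (m + 2) < (c : EReal)) :
    ∃ x ∈ chainSums K α (m + 1), ‖((m + 1 : ℕ) : ℝ)⁻¹ • x.1 - z‖ ≤ ρ ∧
      x.2 ≤ c * ((m + 2 : ℕ) : ℝ) + (α + 1) := by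
  simp only [cellInf, iInf_lt_iff] at h
  obtain ⟨u, ⟨hu, hav⟩, hlt⟩ := h
  refine ⟨_, ⟨fun i => u (i + 1), fun i => hu _, rfl⟩, ?_, ?_⟩
  · rw [discreteAverage_eq (α := α)] at hav
    simpa [dist_eq_norm] using hav
  · rw [EReal.coe_lt_coe_iff, cellSum_eq, one_div, ← div_eq_inv_mul,
      div_lt_iff₀ (by positivity)] at hlt
    have := abs_le.1 (abs_chainEnergy_le hα (u := fun i => u (i + 1)) (fun i => hK1 _ (hu _)) m)
    linarith

/-- The limit of the cell problems at fixed radius. -/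
def cellMin (K : Set E3) (α : ℝ) (z : E3) (ρ : ℝ) : ℝ :=
  sInf {E | ∃ z', (z', E) ∈ asymptoticSet (chainSums K α) ∧ ‖z' - z‖ ≤ ρ}

/-- The lower boundary of the asymptotic set. -/
def lowerEnvelope (K : Set E3) (α : ℝ) (z : E3) : ℝ :=
  sInf {E | (z, E) ∈ asymptoticSet (chainSums K α)}

theorem bddBelow_cell (hα : 0 ≤ α) (hK : K.Nonempty) (hK1 : ∀ w ∈ K, ‖w‖ ≤ 1) (z : E3) (ρ : ℝ) :
    BddBelow {E | ∃ z', (z', E) ∈ asymptoticSet (chainSums K α) ∧ ‖z' - z‖ ≤ ρ} := by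
  refine ⟨-(α + 1), ?_⟩
  rintro E ⟨z', h, -⟩
  have := (isAlmostAdditive_chainSums hα hK hK1).norm_le_of_mem_asymptoticSet h
  exact (abs_le.1 ((norm_snd_le (z', E)).trans this)).1

theorem bddBelow_fiber (hα : 0 ≤ α) (hK : K.Nonempty) (hK1 : ∀ w ∈ K, ‖w‖ ≤ 1) (z : E3) :
    BddBelow {E | (z, E) ∈ asymptoticSet (chainSums K α)} := by
  refine (bddBelow_cell hα hK hK1 z 0).mono fun E hE => ?_
  exact ⟨z, hE, by simp⟩

theorem cellMin_le (hα : 0 ≤ α) (hK : K.Nonempty) (hK1 : ∀ w ∈ K, ‖w‖ ≤ 1) {z : E3} {ρ : ℝ}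
    {w : E3 × ℝ} (hw : w ∈ asymptoticSet (chainSums K α)) (hwz : ‖w.1 - z‖ ≤ ρ) :
    cellMin K α z ρ ≤ w.2 :=
  csInf_le (bddBelow_cell hα hK hK1 z ρ) ⟨w.1, hw, hwz⟩

theorem lowerEnvelope_le (hα : 0 ≤ α) (hK : K.Nonempty) (hK1 : ∀ w ∈ K, ‖w‖ ≤ 1) {z : E3} {E : ℝ}
    (h : (z, E) ∈ asymptoticSet (chainSums K α)) : lowerEnvelope K α z ≤ E := by
  exact csInf_le (bddBelow_fiber hα hK hK1 z) h

theorem mk_lowerEnvelope_mem (hα : 0 ≤ α) (hK1 : ∀ w ∈ K, ‖w‖ ≤ 1) {z : E3}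
    (hz : z ∈ convexHull ℝ K) : (z, lowerEnvelope K α z) ∈ asymptoticSet (chainSums K α) := by
  have hK : K.Nonempty := convexHull_nonempty_iff.1 ⟨z, hz⟩
  have hcl : IsClosed {E : ℝ | (z, E) ∈ asymptoticSet (chainSums K α)} :=
    isClosed_asymptoticSet.preimage (by fun_prop)
  refine hcl.csInf_mem (exists_mem_asymptoticSet hα hK1 hz) ?_
  exact bddBelow_fiber hα hK hK1 z

/-- Bounded sequences converge along ultrafilters. -/
theorem exists_tendsto_ultrafilter {ι V : Type*} [NormedAddCommGroup V] [ProperSpace V]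
    (l : Ultrafilter ι) (y : ι → V) {C : ℝ} (hy : ∀ᶠ i in (l : Filter ι), ‖y i‖ ≤ C) :
    ∃ w, Tendsto y l (𝓝 w) := by
  obtain ⟨w, -, hw⟩ := (isCompact_closedBall (0 : V) C).ultrafilter_le_nhds (l.map y) (by
    rw [Ultrafilter.coe_map, le_principal_iff, mem_map]
    filter_upwards [hy] with i hi
    simpa using hi)
  exact ⟨w, hw⟩

/-- Lower bound: rescaled competitors of small energy converge along an ultrafilter to a point of
the asymptotic set above the closed ball. Upper bound: a near-optimal point may lie above the
boundary of the ball, where approximating chains could leave it, so it is first moved slightly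
towards a point above the centre. -/
theorem tendsto_cellInf (hα : 0 ≤ α) (hK1 : ∀ w ∈ K, ‖w‖ ≤ 1) {z : E3}
    (hz : z ∈ convexHull ℝ K) {ρ : ℝ} (hρ : 0 < ρ) :
    Tendsto (fun k => cellInf K α z ρ k) atTop (𝓝 ((cellMin K α z ρ : ℝ) : EReal)) := by
  have hK : K.Nonempty := convexHull_nonempty_iff.1 ⟨z, hz⟩
  have hT := isAlmostAdditive_chainSums hα hK hK1
  rw [← tendsto_add_atTop_iff_nat 2]
  refine tendsto_order.2 ⟨fun a ha => ?_, fun a ha => ?_⟩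
  · obtain ⟨c, hac, hc⟩ := EReal.lt_iff_exists_real_btwn.1 ha
    by_contra hcon
    have hfreq : ∃ᶠ m in atTop, cellInf K α z ρ (m + 2) < (c : EReal) :=
      (not_eventually.1 hcon).mono fun m hm => (not_lt.1 hm).trans_lt hac
    have : (atTop ⊓ 𝓟 {m | cellInf K α z ρ (m + 2) < (c : EReal)}).NeBot :=
      frequently_mem_iff_neBot.1 hfreq
    set l := Ultrafilter.of (atTop ⊓ 𝓟 {m | cellInf K α z ρ (m + 2) < (c : EReal)})
    have hl : (l : Filter ℕ) ≤ atTop := (Ultrafilter.of_le _).trans inf_le_left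
    have hl' : ∀ᶠ m in (l : Filter ℕ), cellInf K α z ρ (m + 2) < (c : EReal) :=
      (Ultrafilter.of_le _).trans inf_le_right (mem_principal_self _)
    have hex : ∀ m, ∃ x, cellInf K α z ρ (m + 2) < (c : EReal) → x ∈ chainSums K α (m + 1) ∧
        ‖((m + 1 : ℕ) : ℝ)⁻¹ • x.1 - z‖ ≤ ρ ∧ x.2 ≤ c * ((m + 2 : ℕ) : ℝ) + (α + 1) := fun m => by
      by_cases hm : cellInf K α z ρ (m + 2) < (c : EReal)
      · obtain ⟨x, hx⟩ := exists_of_cellInf_lt hα hK1 hm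
        exact ⟨x, fun _ => hx⟩
      · exact ⟨0, fun h => absurd h hm⟩
    choose x hx using hex
    have hxl := hl'.mono fun m hm => hx m hm
    obtain ⟨w, hw⟩ := exists_tendsto_ultrafilter l (fun m => ((m + 1 : ℕ) : ℝ)⁻¹ • x m)
      (C := α + 1) (hxl.mono fun m hm => by
        rw [norm_smul, norm_inv, Real.norm_of_nonneg (by positivity),
          inv_mul_le_iff₀ (by positivity), mul_comm]
        exact hT.norm_le _ _ hm.1)
    have hwA := hT.mem_asymptoticSet_of_tendsto (L := fun m => m + 1)
      ((tendsto_add_atTop_nat 1).mono_left hl) (hxl.mono fun m hm => hm.1) hw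
    have hw1 : ‖w.1 - z‖ ≤ ρ :=
      le_of_tendsto (((continuous_fst.tendsto w).comp hw).sub_const z).norm
        (hxl.mono fun m hm => hm.2.1)
    -- This is `(c * (m + 2) + (α + 1)) / (m + 1)`, the energy bound after rescaling by the number
    -- of spins.
    have hlim : Tendsto (fun m : ℕ => c + (c + (α + 1)) / ((m : ℝ) + 1)) l (𝓝 (c + 0)) :=
      ((tendsto_const_div_atTop_nhds_zero_nat (c + (α + 1))).comp
        (tendsto_add_atTop_nat 1)).const_add c |>.mono_left hl |>.congr fun m => by simp
    have hw2 : w.2 ≤ c + 0 :=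
      le_of_tendsto_of_tendsto ((continuous_snd.tendsto w).comp hw) hlim
        (hxl.mono fun m hm => by
          have h0 : (0 : ℝ) < (m : ℝ) + 1 := by positivity
          have := hm.2.2
          simp only [Function.comp, Prod.smul_snd, smul_eq_mul]
          push_cast at this ⊢
          rw [inv_mul_le_iff₀ h0, mul_add, mul_div_cancel₀ _ h0.ne']
          linarith)
    have := cellMin_le hα hK hK1 hwA hw1
    rw [EReal.coe_lt_coe_iff] at hc
    linarith
  · obtain ⟨c, hc, hca⟩ := EReal.lt_iff_exists_real_btwn.1 ha
    rw [EReal.coe_lt_coe_iff] at hc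
    obtain ⟨E₀, hE₀⟩ := exists_mem_asymptoticSet hα hK1 hz
    obtain ⟨E, ⟨z', hzE, hz'⟩, hEc⟩ :=
      exists_lt_of_csInf_lt (s := {E | ∃ z', (z', E) ∈ asymptoticSet (chainSums K α) ∧ ‖z' - z‖ ≤ ρ})
        ⟨E₀, z, hE₀, by simpa using hρ.le⟩ hc
    obtain ⟨t, ht0, ht1, htE⟩ : ∃ t : ℝ, 0 < t ∧ t < 1 ∧ (1 - t) * E + t * E₀ < c := by
      have h1 : Tendsto (fun t : ℝ => (1 - t) * E + t * E₀) (𝓝[>] 0) (𝓝 ((1 - 0) * E + 0 * E₀)) :=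
        (Continuous.tendsto (by fun_prop) 0).mono_left nhdsWithin_le_nhds
      have h2 := h1.eventually_lt_const (by simpa using hEc)
      obtain ⟨t, ht, ht'⟩ := (h2.and (Ioo_mem_nhdsGT zero_lt_one)).exists
      exact ⟨t, ht'.1, ht'.2, ht⟩
    have hmem := hT.convex_asymptoticSet hzE hE₀ (sub_pos.2 ht1).le ht0.le (sub_add_cancel 1 t)
    set w := (1 - t) • (z', E) + t • (z, E₀) with hw
    have hw1 : ‖w.1 - z‖ ≤ (1 - t) * ρ := by
      have : w.1 - z = (1 - t) • (z' - z) := by simp [hw]; module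
      rw [this, norm_smul, Real.norm_of_nonneg (sub_pos.2 ht1).le]
      gcongr
    have hw2 : w.2 < c := by simpa [hw] using htE
    -- `t * ρ` is the room gained inside the ball. Half of the energy gap `c - w.2` absorbs the
    -- approximation error; the other half absorbs `α + 1` and the passage from `m + 1` to `m + 2`,
    -- by `hlarge`.
    set ε := min (t * ρ) ((c - w.2) / 2) with hε
    have hε0 : 0 < ε := lt_min (by positivity) (by linarith)
    have hε1 : ε ≤ t * ρ := min_le_left _ _
    have hε2 : ε ≤ (c - w.2) / 2 := min_le_right _ _
    have hlarge : ∀ᶠ n : ℕ in atTop, (α + 1 + |c|) / ((c - w.2) / 2) < (n : ℝ) :=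
      tendsto_natCast_atTop_atTop.eventually_gt_atTop _
    filter_upwards [(tendsto_add_atTop_nat 1).eventually ((hmem ε hε0).and hlarge)]
      with m ⟨⟨x, hx, hxw⟩, hm⟩
    have hm0 : (0 : ℝ) < ((m + 1 : ℕ) : ℝ) := by positivity
    refine (cellInf_le hα hK1 hx (ρ := ρ) ?_).trans_lt (lt_trans ?_ hca)
    · have e : ((m + 1 : ℕ) : ℝ)⁻¹ • x.1 - z =
          ((m + 1 : ℕ) : ℝ)⁻¹ • (x - ((m + 1 : ℕ) : ℝ) • w).1 + (w.1 - z) := by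
        rw [Prod.fst_sub, Prod.smul_fst, smul_sub, inv_smul_smul₀ hm0.ne']; abel
      have h1 : ‖((m + 1 : ℕ) : ℝ)⁻¹ • (x - ((m + 1 : ℕ) : ℝ) • w).1‖ ≤ ε := by
        rw [norm_smul, norm_inv, Real.norm_of_nonneg hm0.le, inv_mul_le_iff₀ hm0, mul_comm]
        exact (norm_fst_le _).trans hxw
      rw [e]
      refine (norm_add_le _ _).trans ?_
      linarith
    · rw [EReal.coe_lt_coe_iff, div_lt_iff₀ (by positivity)]
      have h1 := (abs_le.1 ((norm_snd_le _).trans hxw)).2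
      simp only [Prod.snd_sub, Prod.smul_snd, smul_eq_mul] at h1
      rw [div_lt_iff₀ (by linarith)] at hm
      have h2 : ε * ((m + 1 : ℕ) : ℝ) ≤ (c - w.2) / 2 * ((m + 1 : ℕ) : ℝ) := by gcongr
      have h3 := neg_abs_le c
      push_cast at *
      linarith

/-- The minimal point above `z` competes for every `ρ`, which gives the upper bound. Conversely,
near-minimizers converge along an ultrafilter as `ρ → 0`, and closedness puts their limit in the
fibre above `z`. -/
theorem tendsto_cellMin (hα : 0 ≤ α) (hK1 : ∀ w ∈ K, ‖w‖ ≤ 1) {z : E3}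
    (hz : z ∈ convexHull ℝ K) :
    Tendsto (cellMin K α z) (𝓝[>] 0) (𝓝 (lowerEnvelope K α z)) := by
  have hK : K.Nonempty := convexHull_nonempty_iff.1 ⟨z, hz⟩
  have hT := isAlmostAdditive_chainSums hα hK hK1
  have hmem := mk_lowerEnvelope_mem hα hK1 hz
  refine tendsto_order.2 ⟨fun a ha => ?_, fun a ha => ?_⟩
  · by_contra hcon
    have : (𝓝[>] (0 : ℝ) ⊓ 𝓟 {ρ | cellMin K α z ρ ≤ a}).NeBot := frequently_mem_iff_neBot.1
      ((not_eventually.1 hcon).mono fun m hm => not_lt.1 hm)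
    set l := Ultrafilter.of (𝓝[>] (0 : ℝ) ⊓ 𝓟 {ρ | cellMin K α z ρ ≤ a})
    have hl : (l : Filter ℝ) ≤ 𝓝[>] 0 := (Ultrafilter.of_le _).trans inf_le_left
    have hl' : ∀ᶠ ρ in (l : Filter ℝ), cellMin K α z ρ ≤ a :=
      (Ultrafilter.of_le _).trans inf_le_right (mem_principal_self _)
    have hl0 : ∀ᶠ ρ in (l : Filter ℝ), 0 < ρ := hl self_mem_nhdsWithin
    have hex : ∀ ρ, ∃ w : E3 × ℝ, cellMin K α z ρ ≤ a → 0 < ρ →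
        w ∈ asymptoticSet (chainSums K α) ∧ ‖w.1 - z‖ ≤ ρ ∧ w.2 ≤ a + ρ := fun ρ => by
      by_cases h : cellMin K α z ρ ≤ a ∧ 0 < ρ
      · obtain ⟨E, ⟨z', hE, hz'⟩, hlt⟩ := exists_lt_of_csInf_lt
          (s := {E | ∃ z', (z', E) ∈ asymptoticSet (chainSums K α) ∧ ‖z' - z‖ ≤ ρ})
          ⟨_, z, hmem, by simpa using h.2.le⟩ (h.1.trans_lt (lt_add_of_pos_right a h.2))
        exact ⟨(z', E), fun _ _ => ⟨hE, hz', hlt.le⟩⟩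
      · exact ⟨0, fun h1 h2 => absurd ⟨h1, h2⟩ h⟩
    choose w hw using hex
    have hwl := (hl'.and hl0).mono fun ρ hρ => hw ρ hρ.1 hρ.2
    obtain ⟨y, hy⟩ := exists_tendsto_ultrafilter l w
      (hwl.mono fun ρ hρ => hT.norm_le_of_mem_asymptoticSet hρ.1)
    have hid : Tendsto (fun ρ : ℝ => ρ) l (𝓝 0) :=
      tendsto_id.mono_left (hl.trans nhdsWithin_le_nhds)
    have hyA := isClosed_asymptoticSet.mem_of_tendsto hy (hwl.mono fun ρ hρ => hρ.1)
    have hy1 : ‖y.1 - z‖ ≤ 0 := le_of_tendsto_of_tendsto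
      (((continuous_fst.tendsto y).comp hy).sub_const z).norm hid (hwl.mono fun ρ hρ => hρ.2.1)
    have hy2 : y.2 ≤ a + 0 := le_of_tendsto_of_tendsto
      ((continuous_snd.tendsto y).comp hy) (hid.const_add a) (hwl.mono fun ρ hρ => hρ.2.2)
    have hyz : y.1 = z := sub_eq_zero.1 (norm_le_zero_iff.1 hy1)
    have := lowerEnvelope_le hα hK hK1 (z := z) (E := y.2) (hyz ▸ hyA)
    linarith
  · filter_upwards [self_mem_nhdsWithin] with ρ hρ
    exact (cellMin_le hα hK hK1 hmem (by simpa using le_of_lt hρ)).trans_lt ha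

theorem fHom_eq_lowerEnvelope (hα : 0 ≤ α) (hK1 : ∀ w ∈ K, ‖w‖ ≤ 1) {z : E3}
    (hz : z ∈ convexHull ℝ K) : fHom K α z = lowerEnvelope K α z := by
  have h : Tendsto (fun ρ => limUnder atTop fun k => cellInf K α z ρ k) (𝓝[>] 0)
      (𝓝 ((lowerEnvelope K α z : ℝ) : EReal)) := by
    refine Tendsto.congr' ?_ ((continuous_coe_real_ereal.tendsto _).comp
      (tendsto_cellMin hα hK1 hz))
    filter_upwards [self_mem_nhdsWithin] with ρ hρ
    exact (tendsto_cellInf hα hK1 hz hρ).limUnder_eq.symm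
  rw [fHom, h.limUnder_eq, EReal.toReal_coe]

theorem homFormulaHolds (hα : 0 ≤ α) (hK1 : ∀ w ∈ K, ‖w‖ ≤ 1) {z : E3}
    (hz : z ∈ convexHull ℝ K) : HomFormulaHolds K α z :=
  ⟨cellMin K α z, fun _ hρ => tendsto_cellInf hα hK1 hz hρ,
    fHom_eq_lowerEnvelope hα hK1 hz ▸ tendsto_cellMin hα hK1 hz⟩

theorem mk_fHom_mem (hα : 0 ≤ α) (hK1 : ∀ w ∈ K, ‖w‖ ≤ 1) {z : E3} (hz : z ∈ convexHull ℝ K) :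
    (z, fHom K α z) ∈ asymptoticSet (chainSums K α) :=
  fHom_eq_lowerEnvelope hα hK1 hz ▸ mk_lowerEnvelope_mem hα hK1 hz

theorem fHom_le_of_mem (hα : 0 ≤ α) (hKc : IsCompact K) (hK1 : ∀ w ∈ K, ‖w‖ ≤ 1) {w : E3 × ℝ}
    (hw : w ∈ asymptoticSet (chainSums K α)) : fHom K α w.1 ≤ w.2 := by
  have hz := fst_mem_convexHull hKc hw
  rw [fHom_eq_lowerEnvelope hα hK1 hz]
  exact lowerEnvelope_le hα (convexHull_nonempty_iff.1 ⟨_, hz⟩) hK1 hw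

theorem abs_fHom_le (hα : 0 ≤ α) (hK1 : ∀ w ∈ K, ‖w‖ ≤ 1) {z : E3} (hz : z ∈ convexHull ℝ K) :
    |fHom K α z| ≤ α + 1 :=
  (norm_snd_le (z, fHom K α z)).trans
    ((isAlmostAdditive_chainSums hα (convexHull_nonempty_iff.1 ⟨z, hz⟩)
      hK1).norm_le_of_mem_asymptoticSet (mk_fHom_mem hα hK1 hz))

open Classical in
/-- `fHom` on `co K`, extended by a constant that exceeds its values. -/
def extendedFHom (K : Set E3) (α : ℝ) (z : E3) : ℝ :=
  if z ∈ convexHull ℝ K then fHom K α z else α + 1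

theorem extendedFHom_of_mem {z : E3} (hz : z ∈ convexHull ℝ K) :
    extendedFHom K α z = fHom K α z := if_pos hz

theorem abs_extendedFHom_le (hα : 0 ≤ α) (hK1 : ∀ w ∈ K, ‖w‖ ≤ 1) (z : E3) :
    |extendedFHom K α z| ≤ α + 1 := by
  rw [extendedFHom]
  split_ifs with hz
  · exact abs_fHom_le hα hK1 hz
  · rw [abs_of_nonneg (by linarith)]

/-- A sublevel set at height `c < α + 1` is the projection of the compact part of the asymptotic set
with energy at most `c`; at greater heights it is the whole space. -/
theorem lowerSemicontinuous_extendedFHom (hα : 0 ≤ α) (hKc : IsCompact K)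
    (hK1 : ∀ w ∈ K, ‖w‖ ≤ 1) : LowerSemicontinuous (extendedFHom K α) := by
  rw [lowerSemicontinuous_iff_isClosed_preimage]
  intro c
  rcases le_or_gt (α + 1) c with hc | hc
  · convert isClosed_univ
    exact eq_univ_of_forall fun z => (abs_le.1 (abs_extendedFHom_le hα hK1 z)).2.trans hc
  rcases K.eq_empty_or_nonempty with rfl | hK
  · convert isClosed_empty
    refine eq_empty_of_forall_notMem fun z hz => ?_
    have : α + 1 ≤ c := by simpa [extendedFHom] using hz
    linarith
  have hcomp : IsCompact (asymptoticSet (chainSums K α) ∩ {w | w.2 ≤ c}) :=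
    (isAlmostAdditive_chainSums hα hK hK1).isCompact_asymptoticSet.inter_right
      (isClosed_le continuous_snd continuous_const)
  convert (hcomp.image continuous_fst).isClosed
  ext z
  simp only [mem_preimage, mem_Iic, mem_image, mem_inter_iff, mem_ofPred_eq]
  constructor
  · intro h
    have hz : z ∈ convexHull ℝ K := by
      by_contra hz
      rw [extendedFHom, if_neg hz] at h
      linarith
    rw [extendedFHom_of_mem hz] at h
    exact ⟨(z, fHom K α z), ⟨mk_fHom_mem hα hK1 hz, h⟩, rfl⟩
  · rintro ⟨w, ⟨hw, hwc⟩, rfl⟩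
    rw [extendedFHom_of_mem (fst_mem_convexHull hKc hw)]
    exact (fHom_le_of_mem hα hKc hK1 hw).trans hwc

/-! ### Step functions on the lattice -/

section StepFunctions

/-- The step function with value `v i` on `lam * [i, i + 1)`. -/
def stepFun {V : Type*} (lam : ℝ) (v : ℕ → V) (t : ℝ) : V := v ⌊t / lam⌋₊

theorem stronglyMeasurable_stepFun {V : Type*} [TopologicalSpace V] (lam : ℝ) (v : ℕ → V) :
    StronglyMeasurable (stepFun lam v) :=
  (StronglyMeasurable.of_discrete (f := v)).comp_measurable
    (Nat.measurable_floor.comp (measurable_id.div_const lam))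

theorem stepFun_apply {V : Type*} {lam : ℝ} (hlam : 0 < lam) (v : ℕ → V) {i : ℕ} {t : ℝ}
    (h1 : lam * i ≤ t) (h2 : t < lam * (i + 1)) : stepFun lam v t = v i := by
  rw [stepFun, Nat.floor_eq_on_Ico i (t / lam) ⟨by rwa [le_div_iff₀ hlam, mul_comm],
    by rwa [div_lt_iff₀ hlam, mul_comm]⟩]

variable {V : Type*} [NormedAddCommGroup V] [NormedSpace ℝ V] [CompleteSpace V]

theorem integral_stepFun_cell {lam : ℝ} (hlam : 0 < lam) (v : ℕ → V) (i : ℕ) :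
    IntervalIntegrable (stepFun lam v) volume (lam * i) (lam * (i + 1 : ℕ)) ∧
      ∫ t in (lam * i)..(lam * (i + 1 : ℕ)), stepFun lam v t = lam • v i := by
  have hle : lam * i ≤ lam * (i + 1 : ℕ) := by push_cast; nlinarith
  have hae : ∀ᵐ t, t ∈ uIoc (lam * i) (lam * (i + 1 : ℕ)) → v i = stepFun lam v t := by
    filter_upwards [Measure.ae_ne volume (lam * (i + 1 : ℕ))] with t ht hm
    rw [uIoc_of_le hle] at hm
    exact (stepFun_apply hlam v hm.1.le (by
      have := lt_of_le_of_ne hm.2 ht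
      push_cast at this; exact this)).symm
  constructor
  · refine (intervalIntegrable_const (c := v i)).congr_ae ?_
    exact (ae_restrict_iff' measurableSet_uIoc).2 hae
  · rw [← intervalIntegral.integral_congr_ae hae, intervalIntegral.integral_const]
    push_cast
    congr 1; ring

theorem integral_stepFun {lam : ℝ} (hlam : 0 < lam) (v : ℕ → V) (m : ℕ) :
    ∫ t in (0 : ℝ)..(lam * m), stepFun lam v t = lam • ∑ i ∈ Finset.range m, v i := by
  have h := intervalIntegral.sum_integral_adjacent_intervals (f := stepFun lam v) (μ := volume)
    (a := fun i : ℕ => lam * i) (n := m) fun i _ => (integral_stepFun_cell hlam v i).1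
  rw [Finset.smul_sum, ← Finset.sum_congr rfl fun i _ => (integral_stepFun_cell hlam v i).2, h]
  simp

end StepFunctions

/-! ### Cell means, Lebesgue differentiation and primitives -/

section Means

/-- The mean of `U` over the `j`-th cell of the partition into intervals of length `1 / M`. -/
def cellMean (U : ℝ → E3) (M j : ℕ) : E3 :=
  (M : ℝ) • ∫ t in ((j : ℝ) / M)..((j + 1 : ℕ) / M), U t

theorem cellMean_eq_average (U : ℝ → E3) {M : ℕ} (hM : 0 < M) (j : ℕ) :
    cellMean U M j = ⨍ t in Metric.closedBall (((j : ℝ) + 1 / 2) / M) (1 / (2 * M)), U t := by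
  have hM' : (0 : ℝ) < M := by exact_mod_cast hM
  have e1 : ((j : ℝ) + 1 / 2) / M - 1 / (2 * M) = (j : ℝ) / M := by field_simp; ring
  have e2 : ((j : ℝ) + 1 / 2) / M + 1 / (2 * M) = ((j + 1 : ℕ) : ℝ) / M := by
    push_cast; field_simp; ring
  have hle : (j : ℝ) / M ≤ ((j + 1 : ℕ) : ℝ) / M := by gcongr; omega
  rw [Real.closedBall_eq_Icc, e1, e2, setAverage_eq, integral_Icc_eq_integral_Ioc,
    ← intervalIntegral.integral_of_le hle, cellMean, Measure.real, Real.volume_Icc,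
    ENNReal.toReal_ofReal (by linarith)]
  congr 1
  push_cast; field_simp; ring

/-- The cell containing `t` is a ball not centred at `t`, but `t` is within one radius of its
midpoint. The differentiation theorem with moving centres, at ratio `1`, therefore applies. -/
theorem ae_tendsto_cellMean {U : ℝ → E3} (hU : LocallyIntegrable U) :
    ∀ᵐ t : ℝ, 0 ≤ t → Tendsto (fun M : ℕ => cellMean U M ⌊t * M⌋₊) atTop (𝓝 (U t)) := by
  filter_upwards [IsUnifLocDoublingMeasure.ae_tendsto_average (μ := volume) hU 1] with t ht ht0
  have hδ : Tendsto (fun M : ℕ => 1 / (2 * (M : ℝ))) atTop (𝓝[>] 0) := by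
    refine tendsto_nhdsWithin_iff.2 ⟨?_, ?_⟩
    · have := (tendsto_const_div_atTop_nhds_zero_nat (1 / 2 : ℝ))
      refine this.congr fun M => by rw [div_div]
    · filter_upwards [eventually_gt_atTop 0] with M hM
      have hM' : (0 : ℝ) < M := by exact_mod_cast hM
      simp only [mem_Ioi]; positivity
  have key := ht (l := atTop) (fun M : ℕ => ((⌊t * M⌋₊ : ℝ) + 1 / 2) / M)
    (fun M : ℕ => 1 / (2 * (M : ℝ))) hδ (by
      filter_upwards [eventually_gt_atTop 0] with M hM
      have hM' : (0 : ℝ) < M := by exact_mod_cast hM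
      have h1 := Nat.floor_le (show 0 ≤ t * M by positivity)
      have h2 := Nat.lt_floor_add_one (t * (M : ℝ))
      rw [Metric.mem_closedBall, Real.dist_eq]
      have e : t - ((⌊t * M⌋₊ : ℝ) + 1 / 2) / M = (t * M - ⌊t * M⌋₊ - 1 / 2) / M := by
        field_simp; ring
      have e' : 1 * (1 / (2 * (M : ℝ))) = (1 / 2) / M := by field_simp
      rw [e, e', abs_div, abs_of_pos hM']
      gcongr
      rw [abs_le]; constructor <;> linarith)
  refine key.congr' ?_
  filter_upwards [eventually_gt_atTop 0] with M hM
  exact (cellMean_eq_average U hM _).symm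

theorem integral_muI_eq {V : Type*} [NormedAddCommGroup V] [NormedSpace ℝ V] (f : ℝ → V) :
    ∫ t, f t ∂muI = ∫ t in (0 : ℝ)..1, f t := by
  rw [intervalIntegral.integral_of_le zero_le_one, integral_Ioc_eq_integral_Ioo]

/-- The integral of a lower semicontinuous bounded function of `U` is controlled by its values
at the means of `U`. -/
theorem integral_le_of_cellMean {U : ℝ → E3} (hU : Integrable U) {F : E3 → ℝ}
    (hF : LowerSemicontinuous F) {C : ℝ} (hC : ∀ z, |F z| ≤ C) {c : ℝ}
    (h : ∀ M : ℕ, 0 < M → (M : ℝ)⁻¹ * ∑ j ∈ Finset.range M, F (cellMean U M j) ≤ c) :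
    ∫ t, F (U t) ∂muI ≤ c := by
  have hFU : AEStronglyMeasurable (fun t => F (U t)) muI :=
    (hF.measurable.comp_aemeasurable hU.aestronglyMeasurable.aemeasurable.restrict
      ).aestronglyMeasurable
  set G : ℕ → ℝ → ℝ := fun M => stepFun (M : ℝ)⁻¹ fun j => F (cellMean U M j) with hG
  have hGm : ∀ M, AEStronglyMeasurable (G M) muI := fun M =>
    (stronglyMeasurable_stepFun _ _).aestronglyMeasurable
  have hGC : ∀ M t, |G M t| ≤ C := fun M t => hC _
  -- Lower semicontinuity bounds the limit of `G M t` only from below. Truncating by `F (U t)` turns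
  -- this into pointwise convergence, so dominated convergence applies.
  have hlim : Tendsto (fun M => ∫ t, min (G M t) (F (U t)) ∂muI) atTop
      (𝓝 (∫ t, F (U t) ∂muI)) := by
    refine tendsto_integral_of_dominated_convergence (fun _ => C)
      (fun M => (hGm M).inf hFU) (integrable_const C) (fun M => Eventually.of_forall fun t => ?_) ?_
    · rw [Real.norm_eq_abs, abs_le]
      exact ⟨le_min (abs_le.1 (hGC M t)).1 (abs_le.1 (hC _)).1,
        (min_le_right _ _).trans (abs_le.1 (hC _)).2⟩
    · filter_upwards [ae_restrict_of_ae (ae_tendsto_cellMean hU.locallyIntegrable),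
        ae_restrict_mem measurableSet_Ioo] with t ht ht0
      refine tendsto_order.2 ⟨fun a ha => ?_, fun a ha =>
        Eventually.of_forall fun M => (min_le_right _ _).trans_lt ha⟩
      filter_upwards [(ht ht0.1.le).eventually (hF (U t) a ha)] with M hM
      refine lt_min ?_ ha
      simpa only [hG, stepFun, div_inv_eq_mul] using hM
  refine le_of_tendsto hlim ?_
  filter_upwards [eventually_gt_atTop 0] with M hM
  have hM' : (0 : ℝ) < M := by exact_mod_cast hM
  have hGi : Integrable (G M) muI :=
    Integrable.of_bound (hGm M) C (Eventually.of_forall fun t => hGC M t)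
  calc ∫ t, min (G M t) (F (U t)) ∂muI ≤ ∫ t, G M t ∂muI := by
        refine integral_mono (hGi.inf (Integrable.of_bound hFU C
          (Eventually.of_forall fun t => hC _))) hGi fun t => min_le_left _ _
    _ = (M : ℝ)⁻¹ * ∑ j ∈ Finset.range M, F (cellMean U M j) := by
        rw [integral_muI_eq]
        have := integral_stepFun (inv_pos.2 hM') (fun j => F (cellMean U M j)) M
        rwa [inv_mul_cancel₀ hM'.ne', smul_eq_mul] at this
    _ ≤ c := h M hM

/-- The extension of an element of `L^∞(I; ℝ³)` by zero. -/
def zeroExt (u : Linf) : ℝ → E3 := (Ioo (0 : ℝ) 1).indicator u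

theorem integrable_Linf (u : Linf) : Integrable u muI :=
  (Lp.memLp u).integrable le_top

theorem integrable_zeroExt (u : Linf) : Integrable (zeroExt u) :=
  (integrable_indicator_iff measurableSet_Ioo).2 (integrable_Linf u)

theorem intervalIntegrable_zeroExt (u : Linf) (a b : ℝ) :
    IntervalIntegrable (zeroExt u) volume a b := (integrable_zeroExt u).intervalIntegrable

theorem zeroExt_ae_eq (u : Linf) : zeroExt u =ᵐ[muI] u :=
  indicator_ae_eq_restrict measurableSet_Ioo

theorem ae_norm_zeroExt_le {u : Linf} {B : ℝ} (hB : 0 ≤ B) (h : ∀ᵐ t ∂muI, ‖u t‖ ≤ B) :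
    ∀ᵐ t, ‖zeroExt u t‖ ≤ B := by
  filter_upwards [(ae_restrict_iff' measurableSet_Ioo).1 h] with t ht
  by_cases hm : t ∈ Ioo (0 : ℝ) 1
  · simpa [zeroExt, hm] using ht hm
  · simpa [zeroExt, hm] using hB

theorem norm_integral_zeroExt_le {u : Linf} {B : ℝ} (hB : 0 ≤ B) (h : ∀ᵐ t ∂muI, ‖u t‖ ≤ B)
    (a b : ℝ) : ‖∫ t in a..b, zeroExt u t‖ ≤ B * |b - a| := by
  refine intervalIntegral.norm_integral_le_of_norm_le_const_ae ?_
  filter_upwards [ae_norm_zeroExt_le hB h] with t ht _ using ht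

/-- Components of the primitive are pairings with the integrable function `c` on `(0, t]`, hence are
tested by weak-star convergence. -/
theorem inner_integral_zeroExt (u : Linf) (c : E3) (t : ℝ) (ht : 0 ≤ t) :
    inner ℝ c (∫ s in (0 : ℝ)..t, zeroExt u s) =
      ∫ s, inner ℝ (u s) ((Ioc 0 t).indicator (fun _ => c) s) ∂muI := by
  rw [intervalIntegral.integral_of_le ht, ← integral_inner (integrable_zeroExt u).integrableOn,
    ← integral_indicator measurableSet_Ioc, ← integral_indicator measurableSet_Ioo]
  congr 1
  ext s
  by_cases h1 : s ∈ Ioc 0 t <;> by_cases h2 : s ∈ Ioo (0 : ℝ) 1 <;>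
    simp [h1, h2, zeroExt, real_inner_comm]

theorem WeakStarTendsto.tendsto_integral {us : ℕ → Linf} {u : Linf} (h : WeakStarTendsto us u)
    {t : ℝ} (ht : 0 ≤ t) : Tendsto (fun n => ∫ s in (0 : ℝ)..t, zeroExt (us n) s) atTop
      (𝓝 (∫ s in (0 : ℝ)..t, zeroExt u s)) := by
  have hc : ∀ c : E3, Tendsto (fun n => inner ℝ c (∫ s in (0 : ℝ)..t, zeroExt (us n) s)) atTop
      (𝓝 (inner ℝ c (∫ s in (0 : ℝ)..t, zeroExt u s))) := fun c => by
    simp only [inner_integral_zeroExt _ c t ht]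
    exact h _ ((integrable_const c).indicator measurableSet_Ioc)
  let b := EuclideanSpace.basisFun (Fin 3) ℝ
  have e : ∀ x : E3, x = ∑ i, inner ℝ (b i) x • b i := fun x => (b.sum_repr' x).symm
  rw [e (∫ s in (0 : ℝ)..t, zeroExt u s)]
  refine Tendsto.congr (fun n => (e _).symm) (tendsto_finsetSum _ fun i _ => ?_)
  exact (hc (b i)).smul_const _

end Means

/-! ### Lattice blocks and the liminf inequality -/

theorem natCast_floor_inv {lam : ℝ} (hlam : 0 < lam) :
    ((⌊1 / lam⌋₊ : ℕ) : ℤ) = ⌊1 / lam⌋ := Int.natCast_floor_eq_floor (by positivity)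

/-- With `N = ⌊1 / lam⌋₊`, removing the last two indices leaves `0, …, N - 2`, that is `N - 1`
terms, and these read no site beyond `N`. -/
theorem latticeEnergy_eq {lam : ℝ} (hlam : 0 < lam) (hlam1 : lam ≤ 1) {v : ℤ → E3} {w : ℕ → E3}
    (h : ∀ i : ℕ, i ≤ ⌊1 / lam⌋₊ → w i = v i) :
    latticeEnergy α lam v = lam * (chainSum α w (⌊1 / lam⌋₊ - 1)).2 := by
  have hN : 1 ≤ ⌊1 / lam⌋₊ := Nat.le_floor (by rw [le_div_iff₀ hlam]; simpa using hlam1)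
  rw [latticeEnergy, chainSum_snd, bulkIdx, latticeIdx, ← natCast_floor_inv hlam]
  generalize ⌊1 / lam⌋₊ = N at *
  congr 1
  refine Finset.sum_bij' (fun i _ => i.toNat) (fun r _ => (r : ℤ)) ?_ ?_ ?_ ?_ ?_
  · intro i hi; simp at hi ⊢; omega
  · intro i hi; simp at hi ⊢; omega
  · intro i hi; simp at hi ⊢; omega
  · intro i hi; simp
  · intro i hi
    simp only [Finset.mem_sdiff, Finset.mem_Icc, Finset.mem_insert, Finset.mem_singleton] at hi
    obtain ⟨r, rfl⟩ := Int.eq_ofNat_of_zero_le hi.1.1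
    rw [chainEnergy, Int.toNat_natCast, h r (by omega), h (r + 1) (by omega), h (r + 2) (by omega)]
    push_cast
    rfl

theorem norm_chainSum_sub_chainSum_le (hα : 0 ≤ α) {u : ℕ → E3} (hu : ∀ i, ‖u i‖ ≤ 1) (m n : ℕ) :
    ‖chainSum α u m - chainSum α u n‖ ≤ (α + 1) * |(m : ℝ) - n| := by
  wlog h : n ≤ m generalizing m n
  · rw [norm_sub_rev, abs_sub_comm]
    exact this n m (not_le.1 h).le
  obtain ⟨k, rfl⟩ := Nat.exists_eq_add_of_le h
  rw [chainSum_add, add_sub_cancel_left]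
  refine (norm_chainSum_le hα (fun i => hu _) k).trans_eq ?_
  simp

/-- The number of lattice sites in the cells of length `1 / M`. -/
def blockLen (lam : ℝ) (M : ℕ) : ℕ := ⌊1 / ((M : ℝ) * lam)⌋₊

theorem mul_blockLen_le {lam : ℝ} (hlam : 0 < lam) {M : ℕ} (hM : 0 < M) :
    lam * (M * blockLen lam M) ≤ 1 := by
  have hM' : (0 : ℝ) < M := by exact_mod_cast hM
  have := Nat.floor_le (show 0 ≤ 1 / ((M : ℝ) * lam) by positivity)
  rw [le_div_iff₀ (by positivity)] at this
  rw [blockLen]; linarith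

theorem lt_mul_blockLen {lam : ℝ} (hlam : 0 < lam) {M : ℕ} (hM : 0 < M) :
    1 < lam * (M * blockLen lam M) + M * lam := by
  have hM' : (0 : ℝ) < M := by exact_mod_cast hM
  have := Nat.lt_floor_add_one (1 / ((M : ℝ) * lam))
  rw [div_lt_iff₀ (by positivity)] at this
  rw [blockLen]; linarith

theorem mul_blockLen_le_floor {lam : ℝ} (hlam : 0 < lam) {M : ℕ} (hM : 0 < M) :
    M * blockLen lam M ≤ ⌊1 / lam⌋₊ := by
  refine Nat.le_floor ?_
  rw [le_div_iff₀ hlam]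
  push_cast
  linarith [mul_blockLen_le hlam hM]

theorem abs_mul_blockLen_sub_le {lam : ℝ} (hlam : 0 < lam) {M : ℕ} (hM : 0 < M) {j : ℕ}
    (hj : j ≤ M) : |lam * ((j * blockLen lam M : ℕ) : ℝ) - j / M| ≤ M * lam := by
  have hM' : (0 : ℝ) < M := by exact_mod_cast hM
  have hjM : (j : ℝ) / M ≤ 1 := by rw [div_le_one hM']; exact_mod_cast hj
  have h1 := mul_blockLen_le hlam hM
  have h2 := lt_mul_blockLen hlam hM
  have e : lam * ((j * blockLen lam M : ℕ) : ℝ) - j / M =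
      (j / M : ℝ) * (lam * (M * blockLen lam M) - 1) := by
    push_cast; field_simp
  rw [e, abs_mul, abs_of_nonneg (by positivity)]
  calc (j / M : ℝ) * |lam * (M * blockLen lam M) - 1| ≤ 1 * (M * lam) := by
        gcongr
        rw [abs_le]; constructor <;> nlinarith
    _ = M * lam := one_mul _

theorem abs_floor_sub_mul_blockLen_le {lam : ℝ} (hlam : 0 < lam) (hlam1 : lam ≤ 1) {M : ℕ}
    (hM : 0 < M) : |((⌊1 / lam⌋₊ - 1 : ℕ) : ℝ) - ((M * blockLen lam M : ℕ) : ℝ)| ≤ M + 1 := by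
  have hN : 1 ≤ ⌊1 / lam⌋₊ := Nat.le_floor (by rw [le_div_iff₀ hlam]; simpa using hlam1)
  have h1 := mul_blockLen_le_floor hlam hM
  have h2 := lt_mul_blockLen hlam hM
  have h3 := Nat.floor_le (show 0 ≤ 1 / lam by positivity)
  rw [le_div_iff₀ hlam] at h3
  have h4 : (⌊1 / lam⌋₊ : ℝ) < M * blockLen lam M + M := by
    by_contra! hcon
    nlinarith
  have h1' : (M * blockLen lam M : ℝ) ≤ ⌊1 / lam⌋₊ := by exact_mod_cast h1
  have hM' : (0 : ℝ) < M := by exact_mod_cast hM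
  rw [Nat.cast_sub hN, abs_le]
  push_cast
  constructor <;> linarith

theorem tendsto_blockLen {lam : ℕ → ℝ} (hpos : ∀ n, 0 < lam n) (hlam : Tendsto lam atTop (𝓝 0))
    {M : ℕ} (hM : 0 < M) : Tendsto (fun n => blockLen (lam n) M) atTop atTop := by
  have hM' : (0 : ℝ) < M := by exact_mod_cast hM
  refine tendsto_nat_floor_atTop.comp ?_
  have h0 : Tendsto (fun n => (M : ℝ) * lam n) atTop (𝓝[>] 0) :=
    tendsto_nhdsWithin_iff.2 ⟨by simpa using hlam.const_mul (M : ℝ),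
      Eventually.of_forall fun n => mul_pos hM' (hpos n)⟩
  exact h0.inv_tendsto_nhdsGT_zero.congr fun n => (one_div _).symm

theorem tendsto_mul_blockLen {lam : ℕ → ℝ} (hpos : ∀ n, 0 < lam n)
    (hlam : Tendsto lam atTop (𝓝 0)) {M : ℕ} (hM : 0 < M) :
    Tendsto (fun n => lam n * blockLen (lam n) M) atTop (𝓝 ((M : ℝ)⁻¹)) := by
  have hM' : (0 : ℝ) < M := by exact_mod_cast hM
  have h : Tendsto (fun n => (M : ℝ) * lam n) atTop (𝓝 0) := by simpa using hlam.const_mul (M : ℝ)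
  refine tendsto_iff_dist_tendsto_zero.2 (squeeze_zero (fun _ => dist_nonneg) (fun n => ?_) h)
  simpa [Real.dist_eq] using abs_mul_blockLen_sub_le (hpos n) hM (j := 1) hM

/-- Integrals of functions that agree on `I` with a step function. -/
theorem integral_zeroExt_of_stepFun {lam : ℝ} (hlam : 0 < lam) {u : Linf} {v : ℕ → E3}
    (h : u =ᵐ[muI] stepFun lam v) {m : ℕ} (hm : lam * m ≤ 1) :
    ∫ t in (0 : ℝ)..(lam * m), zeroExt u t = lam • ∑ i ∈ Finset.range m, v i := by
  rw [← integral_stepFun hlam]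
  refine intervalIntegral.integral_congr_ae ?_
  filter_upwards [(ae_restrict_iff' measurableSet_Ioo).1 h, Measure.ae_ne volume (1 : ℝ)]
    with t ht ht1 hmem
  rw [uIoc_of_le (by positivity)] at hmem
  have h0 : t ∈ Ioo (0 : ℝ) 1 := ⟨hmem.1, lt_of_le_of_ne (hmem.2.trans hm) ht1⟩
  rw [zeroExt, indicator_of_mem h0, ht h0]

/-- Blow-up of the energy bound on the cells of a partition of `I`. -/
theorem cellMean_mem_and_sum_fHom_le (hα : 0 ≤ α) (hKc : IsCompact K) (hK : K.Nonempty)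
    (hK1 : ∀ w ∈ K, ‖w‖ ≤ 1) {lam : ℕ → ℝ} (hpos : ∀ n, 0 < lam n)
    (hlam : Tendsto lam atTop (𝓝 0)) {u : Linf} {us : ℕ → Linf} (hu : WeakStarTendsto us u)
    (l : Ultrafilter ℕ) (hl : (l : Filter ℕ) ≤ atTop) {v : ℕ → ℕ → E3} (hv : ∀ n i, v n i ∈ K)
    (hus : ∀ᶠ n in (l : Filter ℕ), us n =ᵐ[muI] stepFun (lam n) (v n)) {c : ℝ}
    (hc : ∀ᶠ n in (l : Filter ℕ), lam n * (chainSum α (v n) (⌊1 / lam n⌋₊ - 1)).2 ≤ c)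
    {M : ℕ} (hM : 0 < M) :
    (∀ j < M, cellMean (zeroExt u) M j ∈ convexHull ℝ K) ∧
      (M : ℝ)⁻¹ * ∑ j ∈ Finset.range M, fHom K α (cellMean (zeroExt u) M j) ≤ c := by
  have hM' : (0 : ℝ) < M := by exact_mod_cast hM
  have hT := isAlmostAdditive_chainSums hα hK hK1
  have hv1 : ∀ n i, ‖v n i‖ ≤ 1 := fun n i => hK1 _ (hv n i)
  have hlam' : Tendsto lam l (𝓝 0) := hlam.mono_left hl
  have hMlam : Tendsto (fun n => (M : ℝ) * lam n) l (𝓝 0) := by simpa using hlam'.const_mul (M : ℝ)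
  have hL : Tendsto (fun n => blockLen (lam n) M) l atTop :=
    (tendsto_blockLen hpos hlam hM).mono_left hl
  have hlamL : Tendsto (fun n => lam n * blockLen (lam n) M) l (𝓝 ((M : ℝ)⁻¹)) :=
    (tendsto_mul_blockLen hpos hlam hM).mono_left hl
  set x : ℕ → ℕ → E3 × ℝ := fun j n =>
    chainSum α (fun i => v n (j * blockLen (lam n) M + i)) (blockLen (lam n) M) with hx
  have hxT : ∀ j n, x j n ∈ chainSums K α (blockLen (lam n) M) := fun j n =>
    ⟨_, fun i => hv n _, rfl⟩
  have hex : ∀ j, ∃ w, Tendsto (fun n => (blockLen (lam n) M : ℝ)⁻¹ • x j n) l (𝓝 w) := fun j => by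
    refine exists_tendsto_ultrafilter l _ (C := α + 1) ?_
    filter_upwards [hL.eventually_gt_atTop 0] with n hn
    have hn' : (0 : ℝ) < blockLen (lam n) M := by exact_mod_cast hn
    rw [norm_smul, norm_inv, Real.norm_of_nonneg hn'.le, inv_mul_le_iff₀ hn', mul_comm]
    exact hT.norm_le _ _ (hxT j n)
  choose w hw using hex
  have hwA : ∀ j, w j ∈ asymptoticSet (chainSums K α) := fun j =>
    hT.mem_asymptoticSet_of_tendsto hL (Eventually.of_forall (hxT j)) (hw j)
  have hxw : ∀ j, Tendsto (fun n => lam n • x j n) l (𝓝 ((M : ℝ)⁻¹ • w j)) := fun j => by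
    refine (hlamL.smul (hw j)).congr' ?_
    filter_upwards [hL.eventually_gt_atTop 0] with n hn
    have hn' : (blockLen (lam n) M : ℝ) ≠ 0 := by exact_mod_cast hn.ne'
    rw [smul_smul, mul_assoc, mul_inv_cancel₀ hn', mul_one]
  -- The first `j` blocks end at `lam n * (j * blockLen (lam n) M)`, within `M * lam n` of `j / M`.
  -- As the spins have norm at most `1`, the two primitives differ by no more than that.
  have hprim : ∀ j ≤ M, Tendsto
      (fun n => lam n • ∑ i ∈ Finset.range (j * blockLen (lam n) M), v n i) l
      (𝓝 (∫ t in (0 : ℝ)..(j / M : ℝ), zeroExt u t)) := fun j hj => by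
    have h1 := (hu.tendsto_integral (show (0 : ℝ) ≤ j / M by positivity)).mono_left hl
    refine (tendsto_iff_of_dist ?_).1 h1
    refine squeeze_zero' (Eventually.of_forall fun _ => dist_nonneg) ?_ hMlam
    filter_upwards [hus] with n hn
    have hle : lam n * ((j * blockLen (lam n) M : ℕ) : ℝ) ≤ 1 := by
      have h2 := mul_blockLen_le (hpos n) hM
      have h3 : (j : ℝ) ≤ M := by exact_mod_cast hj
      have h4 := (hpos n).le
      push_cast
      refine le_trans ?_ h2
      gcongr
    rw [← integral_zeroExt_of_stepFun (hpos n) hn hle, dist_eq_norm,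
      intervalIntegral.integral_interval_sub_left (intervalIntegrable_zeroExt _ _ _)
        (intervalIntegrable_zeroExt _ _ _)]
    refine (norm_integral_zeroExt_le zero_le_one ?_ _ _).trans ?_
    · filter_upwards [hn] with t ht
      rw [ht]
      exact hv1 _ _
    · rw [one_mul, abs_sub_comm]
      exact abs_mul_blockLen_sub_le (hpos n) hM hj
  -- Subtracting consecutive primitives gives the limit of the spin sum of block `j`; uniqueness of
  -- limits identifies it with the integral of `u` over the cell.
  have hmean : ∀ j < M, (w j).1 = cellMean (zeroExt u) M j := fun j hj => by
    have h1 := (hprim (j + 1) hj).sub (hprim j hj.le)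
    rw [intervalIntegral.integral_interval_sub_left (intervalIntegrable_zeroExt _ _ _)
      (intervalIntegrable_zeroExt _ _ _)] at h1
    have h2 : Tendsto (fun n => (lam n • x j n).1) l (𝓝 ((M : ℝ)⁻¹ • w j).1) :=
      (continuous_fst.tendsto _).comp (hxw j)
    have h3 := tendsto_nhds_unique h2 (h1.congr fun n => by
      rw [Nat.succ_mul, Finset.sum_range_add, smul_add, add_sub_cancel_left, Prod.smul_fst, hx,
        chainSum_fst])
    rw [cellMean, ← h3, Prod.smul_fst, smul_inv_smul₀ hM'.ne']
  refine ⟨fun j hj => hmean j hj ▸ fst_mem_convexHull hKc (hwA j), ?_⟩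
  have hsum : Tendsto (fun n => lam n * (chainSum α (v n) (M * blockLen (lam n) M)).2) l
      (𝓝 ((M : ℝ)⁻¹ * ∑ j ∈ Finset.range M, (w j).2)) := by
    rw [Finset.mul_sum]
    refine (tendsto_finsetSum (Finset.range M) fun j _ =>
      (continuous_snd.tendsto _).comp (hxw j)).congr fun n => ?_
    rw [chainSum_mul, Prod.snd_sum, Finset.mul_sum]
    rfl
  -- The number of sites in the blocks and the number of energy terms differ by at most `M + 1`, and
  -- each term is at most `α + 1` in size.
  have hbound : ∀ᶠ n in (l : Filter ℕ), lam n * (chainSum α (v n) (M * blockLen (lam n) M)).2 ≤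
      c + (α + 1) * (M + 1) * lam n := by
    filter_upwards [hc, hlam'.eventually_le_const zero_lt_one] with n hn hn1
    have h1 := (norm_snd_le _).trans
      (norm_chainSum_sub_chainSum_le hα (hv1 n) (⌊1 / lam n⌋₊ - 1) (M * blockLen (lam n) M))
    have h2 := (abs_le.1 h1).1
    have h3 := abs_floor_sub_mul_blockLen_le (hpos n) hn1 hM
    have h4 := mul_le_mul_of_nonneg_left h3 (show 0 ≤ α + 1 by linarith)
    rw [Prod.snd_sub] at h2
    have h5 := hpos n
    nlinarith
  have hlim : Tendsto (fun n => c + (α + 1) * (M + 1) * lam n) l (𝓝 c) := by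
    simpa using (hlam'.const_mul ((α + 1) * (M + 1))).const_add c
  refine le_trans ?_ (le_of_tendsto_of_tendsto hsum hlim hbound)
  gcongr with j hj
  rw [← hmean j (Finset.mem_range.1 hj)]
  exact fHom_le_of_mem hα hKc hK1 (hwA j)

theorem measurable_fHom_comp (hα : 0 ≤ α) (hKc : IsCompact K) (hK1 : ∀ w ∈ K, ‖w‖ ≤ 1)
    {u : Linf} (hu : ∀ᵐ t ∂muI, u t ∈ convexHull ℝ K) :
    AEStronglyMeasurable (fun t => fHom K α (u t)) muI := by
  have h := (lowerSemicontinuous_extendedFHom hα hKc hK1).measurable.comp_aemeasurable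
    (Lp.aestronglyMeasurable u).aemeasurable
  refine h.aestronglyMeasurable.congr ?_
  filter_upwards [hu] with t ht using extendedFHom_of_mem ht

theorem integrable_fHom_comp (hα : 0 ≤ α) (hKc : IsCompact K) (hK1 : ∀ w ∈ K, ‖w‖ ≤ 1)
    {u : Linf} (hu : ∀ᵐ t ∂muI, u t ∈ convexHull ℝ K) :
    Integrable (fun t => fHom K α (u t)) muI :=
  Integrable.of_bound (measurable_fHom_comp hα hKc hK1 hu) (α + 1)
    (hu.mono fun _ ht => abs_fHom_le hα hK1 ht)

/-- If the inequality failed, some real `c` would lie strictly between the two sides, with energies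
below `c` along an ultrafilter. The block estimate then places the cell means in `co K`, hence `u`
almost everywhere, and bounds the limit energy by `c`. -/
theorem limitEnergy_le_liminf (hα : 0 ≤ α) (hKc : IsCompact K) (hK1 : ∀ w ∈ K, ‖w‖ ≤ 1)
    {lam : ℕ → ℝ} (hpos : ∀ n, 0 < lam n) (hlam : Tendsto lam atTop (𝓝 0)) {u : Linf}
    {us : ℕ → Linf} (hu : WeakStarTendsto us u) :
    limitEnergy K α u ≤ liminf (fun n => bulkEnergy K α (lam n) (us n)) atTop := by
  by_contra! hcon
  obtain ⟨c, hc1, hc2⟩ := EReal.lt_iff_exists_real_btwn.1 hcon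
  have hfreq : ∃ᶠ n in atTop, bulkEnergy K α (lam n) (us n) < (c : EReal) :=
    frequently_lt_of_liminf_lt (by isBoundedDefault) hc1
  have : (atTop ⊓ 𝓟 {n | bulkEnergy K α (lam n) (us n) < (c : EReal)}).NeBot :=
    frequently_mem_iff_neBot.1 hfreq
  set l := Ultrafilter.of (atTop ⊓ 𝓟 {n | bulkEnergy K α (lam n) (us n) < (c : EReal)})
  have hl : (l : Filter ℕ) ≤ atTop := (Ultrafilter.of_le _).trans inf_le_left
  have hl' : ∀ᶠ n in (l : Filter ℕ), bulkEnergy K α (lam n) (us n) < (c : EReal) :=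
    (Ultrafilter.of_le _).trans inf_le_right (mem_principal_self _)
  have hl1 : ∀ᶠ n in (l : Filter ℕ), lam n ≤ 1 := hl (hlam.eventually_le_const zero_lt_one)
  have hgood : ∀ n, bulkEnergy K α (lam n) (us n) < (c : EReal) → lam n ≤ 1 →
      ∃ v : ℕ → E3, (∀ i, v i ∈ K) ∧ us n =ᵐ[muI] stepFun (lam n) v ∧
        lam n * (chainSum α v (⌊1 / lam n⌋₊ - 1)).2 ≤ c := fun n hn hn1 => by
    simp only [bulkEnergy, iInf_lt_iff] at hn
    obtain ⟨v, ⟨⟨hvK, -⟩, hvu⟩, hlt⟩ := hn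
    have hN := natCast_floor_inv (hpos n)
    have hvN : ∀ i : ℕ, i ≤ ⌊1 / lam n⌋₊ → v i ∈ K := fun i hi => hvK _ (by
      rw [latticeIdx, ← hN, Finset.mem_Icc]; omega)
    -- Admissibility constrains only lattice indices; beyond them the chain is reset to `v 0` so
    -- that it is `K`-valued everywhere. Neither the function on `I` nor the energy sees the change.
    refine ⟨fun i => if i ≤ ⌊1 / lam n⌋₊ then v i else v 0, fun i => ?_, ?_, ?_⟩
    · beta_reduce
      split_ifs with h
      exacts [hvN i h, by simpa using hvN 0 (Nat.zero_le _)]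
    · filter_upwards [hvu, ae_restrict_mem measurableSet_Ioo] with t ht ht0
      have h0 : 0 ≤ t / lam n := div_nonneg ht0.1.le (hpos n).le
      have hle : ⌊t / lam n⌋₊ ≤ ⌊1 / lam n⌋₊ :=
        Nat.floor_le_floor (div_le_div_of_nonneg_right ht0.2.le (hpos n).le)
      rw [ht, pcExtension, stepFun, if_pos hle, Int.natCast_floor_eq_floor h0]
    · rw [← latticeEnergy_eq (hpos n) hn1 (v := v) fun i hi => if_pos hi]
      exact (EReal.coe_lt_coe_iff.1 hlt).le
  obtain ⟨n₀, hn₀, hn₀1⟩ := (hl'.and hl1).exists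
  obtain ⟨v₀, hv₀, -⟩ := hgood n₀ hn₀ hn₀1
  have hK : K.Nonempty := ⟨_, hv₀ 0⟩
  have hex : ∀ n, ∃ v : ℕ → E3, (∀ i, v i ∈ K) ∧ (bulkEnergy K α (lam n) (us n) < (c : EReal) →
      lam n ≤ 1 → us n =ᵐ[muI] stepFun (lam n) v ∧
        lam n * (chainSum α v (⌊1 / lam n⌋₊ - 1)).2 ≤ c) := fun n => by
    by_cases h : bulkEnergy K α (lam n) (us n) < (c : EReal) ∧ lam n ≤ 1
    · obtain ⟨v, hv, hv'⟩ := hgood n h.1 h.2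
      exact ⟨v, hv, fun _ _ => hv'⟩
    · exact ⟨v₀, hv₀, fun h1 h2 => absurd ⟨h1, h2⟩ h⟩
  choose v hvK hv using hex
  have hev := (hl'.and hl1).mono fun n hn => hv n hn.1 hn.2
  have key := fun (M : ℕ) (hM : 0 < M) => cellMean_mem_and_sum_fHom_le hα hKc hK hK1 hpos hlam hu l
    hl hvK (hev.mono fun n hn => hn.1) (hev.mono fun n hn => hn.2) hM
  have hcl : IsClosed (convexHull ℝ K) := (isCompact_convexHull hKc).isClosed
  have hco : ∀ᵐ t ∂muI, u t ∈ convexHull ℝ K := by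
    filter_upwards [zeroExt_ae_eq u, ae_restrict_mem measurableSet_Ioo,
      ae_restrict_of_ae (ae_tendsto_cellMean (integrable_zeroExt u).locallyIntegrable)]
      with t ht ht0 hlim
    rw [← ht]
    refine hcl.mem_of_tendsto (hlim ht0.1.le) ?_
    filter_upwards [eventually_gt_atTop 0] with M hM
    have hM' : (0 : ℝ) < M := by exact_mod_cast hM
    refine (key M hM).1 _ ((Nat.floor_lt (by have := ht0.1; positivity)).2 ?_)
    nlinarith [ht0.2]
  have hint : ∫ t, fHom K α (u t) ∂muI ≤ c := by
    have h := integral_le_of_cellMean (integrable_zeroExt u)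
      (lowerSemicontinuous_extendedFHom hα hKc hK1) (abs_extendedFHom_le hα hK1) (c := c)
      fun M hM => by
        rw [Finset.sum_congr rfl fun j hj =>
          extendedFHom_of_mem ((key M hM).1 j (Finset.mem_range.1 hj))]
        exact (key M hM).2
    refine le_of_eq_of_le (integral_congr_ae ?_) h
    filter_upwards [zeroExt_ae_eq u, hco] with t ht htc
    rw [ht, extendedFHom_of_mem htc]
  rw [limitEnergy, if_pos hco, EReal.coe_lt_coe_iff] at hc2
  linarith

/-! ### Weak-star convergence from convergence of primitives -/

section WeakStar

theorem integral_Iic_muI_eq (u : Linf) (a : ℝ) :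
    ∫ t in Iic a, u t ∂muI = ∫ t in (0 : ℝ)..(max 0 (min a 1)), zeroExt u t := by
  rw [intervalIntegral.integral_of_le (le_max_left _ _), zeroExt,
    setIntegral_indicator measurableSet_Ioo, Measure.restrict_restrict measurableSet_Iic]
  congr 2
  ext s
  simp only [mem_inter_iff, mem_Iic, mem_Ioo, mem_Ioc, le_max_iff, le_min_iff]
  constructor
  · rintro ⟨h1, h2, h3⟩
    exact ⟨⟨h2, Or.inr ⟨h1, h3.le⟩⟩, h2, h3⟩
  · rintro ⟨⟨h1, h2⟩, h3, h4⟩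
    refine ⟨?_, h3, h4⟩
    rcases h2 with h2 | h2
    · linarith
    · exact h2.1

theorem integral_muI_eq_zeroExt (u : Linf) : ∫ t, u t ∂muI = ∫ t in (0 : ℝ)..1, zeroExt u t := by
  rw [← integral_muI_eq]
  exact integral_congr_ae (zeroExt_ae_eq u).symm

theorem norm_setIntegral_muI_le {u : Linf} (hu : ∀ᵐ t ∂muI, ‖u t‖ ≤ 1) (s : Set ℝ) :
    ‖∫ t in s, u t ∂muI‖ ≤ muI.real s := by
  simpa using norm_setIntegral_le_of_norm_le_const_ae' (C := 1) (measure_lt_top muI s)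
    (hu.mono fun t ht _ => ht)

/-- Induction from the π-system of half-lines. For disjoint unions, the bound `‖us n t‖ ≤ 1`
dominates the series by the measures of the pieces, uniformly in `n`. -/
theorem tendsto_setIntegral_of_primitive {us : ℕ → Linf} {u : Linf}
    (hus : ∀ n, ∀ᵐ t ∂muI, ‖us n t‖ ≤ 1)
    (h : ∀ t ∈ Icc (0 : ℝ) 1, Tendsto (fun n => ∫ s in (0 : ℝ)..t, zeroExt (us n) s) atTop
      (𝓝 (∫ s in (0 : ℝ)..t, zeroExt u s))) (s : Set ℝ) (hs : MeasurableSet s) :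
    Tendsto (fun n => ∫ t in s, us n t ∂muI) atTop (𝓝 (∫ t in s, u t ∂muI)) := by
  have heq : (inferInstance : MeasurableSpace ℝ) = MeasurableSpace.generateFrom (range Iic) :=
    (BorelSpace.measurable_eq (α := ℝ)).trans (borel_eq_generateFrom_Iic ℝ)
  induction s, hs using MeasurableSpace.induction_on_inter heq isPiSystem_Iic with
  | empty => simp
  | basic t ht =>
    obtain ⟨a, rfl⟩ := ht
    simp only [integral_Iic_muI_eq]
    exact h _ ⟨le_max_left _ _, max_le zero_le_one (min_le_right _ _)⟩
  | compl t ht ih =>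
    have e : ∀ w : Linf, ∫ x in tᶜ, w x ∂muI =
        (∫ x in (0 : ℝ)..1, zeroExt w x) - ∫ x in t, w x ∂muI := fun w => by
      rw [← integral_muI_eq_zeroExt, ← integral_add_compl ht (integrable_Linf w),
        add_sub_cancel_left]
    simp only [e]
    exact (h 1 (right_mem_Icc.2 zero_le_one)).sub ih
  | iUnion f hd hf ih =>
    have e : ∀ w : Linf, ∫ x in ⋃ i, f i, w x ∂muI = ∑' i, ∫ x in f i, w x ∂muI := fun w =>
      integral_iUnion hf hd (integrable_Linf w).integrableOn
    simp only [e]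
    exact tendsto_tsum_of_dominated_convergence (summable_measure_toReal hf hd) ih
      (Eventually.of_forall fun n i => norm_setIntegral_muI_le (hus n) _)

theorem ae_norm_inner_le {u : Linf} (hu : ∀ᵐ t ∂muI, ‖u t‖ ≤ 1) (g : ℝ → E3) :
    ∀ᵐ t ∂muI, ‖inner ℝ (u t) (g t)‖ ≤ ‖g t‖ := by
  filter_upwards [hu] with t ht
  exact (norm_inner_le_norm _ _).trans (mul_le_of_le_one_left (norm_nonneg _) ht)

theorem integrable_inner_Linf {u : Linf} (hu : ∀ᵐ t ∂muI, ‖u t‖ ≤ 1) {g : ℝ → E3}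
    (hg : Integrable g muI) : Integrable (fun t => inner ℝ (u t) (g t)) muI :=
  hg.norm.mono' ((Lp.aestronglyMeasurable u).inner hg.aestronglyMeasurable) (ae_norm_inner_le hu g)

theorem abs_integral_inner_sub_le {u : Linf} (hu : ∀ᵐ t ∂muI, ‖u t‖ ≤ 1) {f g : ℝ → E3}
    (hf : Integrable f muI) (hg : Integrable g muI) :
    |∫ t, inner ℝ (u t) (f t) ∂muI - ∫ t, inner ℝ (u t) (g t) ∂muI| ≤
      ∫ t, ‖f t - g t‖ ∂muI := by
  rw [← integral_sub (integrable_inner_Linf hu hf) (integrable_inner_Linf hu hg)]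
  simp only [← inner_sub_right]
  exact norm_integral_le_of_norm_le (hf.sub hg).norm (ae_norm_inner_le hu _)

/-- On bounded sequences, convergence of the primitives implies weak-star convergence. -/
theorem weakStarTendsto_of_primitive {us : ℕ → Linf} {u : Linf}
    (hus : ∀ n, ∀ᵐ t ∂muI, ‖us n t‖ ≤ 1) (hu : ∀ᵐ t ∂muI, ‖u t‖ ≤ 1)
    (h : ∀ t ∈ Icc (0 : ℝ) 1, Tendsto (fun n => ∫ s in (0 : ℝ)..t, zeroExt (us n) s) atTop
      (𝓝 (∫ s in (0 : ℝ)..t, zeroExt u s))) : WeakStarTendsto us u := by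
  intro g hg
  refine Integrable.induction (fun g : ℝ → E3 =>
    Tendsto (fun n => ∫ t, inner ℝ (us n t) (g t) ∂muI) atTop (𝓝 (∫ t, inner ℝ (u t) (g t) ∂muI)))
    (fun c s hs _ => ?_) (fun _ _ _ hf hg ihf ihg => ?_) ?_ (fun _ _ hfg _ ih => ?_) hg
  · have e : ∀ w : Linf, ∫ t, inner ℝ (w t) (s.indicator (fun _ => c) t) ∂muI =
        inner ℝ c (∫ t in s, w t ∂muI) := fun w => by
      rw [← integral_inner (integrable_Linf w).integrableOn, ← integral_indicator hs]
      congr 1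
      ext t
      by_cases ht : t ∈ s <;> simp [ht, real_inner_comm]
    simp only [e]
    exact tendsto_const_nhds.inner (tendsto_setIntegral_of_primitive hus h s hs)
  · simp only [Pi.add_apply, inner_add_right]
    rw [integral_add (integrable_inner_Linf hu hf) (integrable_inner_Linf hu hg)]
    refine (ihf.add ihg).congr fun n => ?_
    rw [integral_add (integrable_inner_Linf (hus n) hf) (integrable_inner_Linf (hus n) hg)]
  -- The pairings with `us n` and with `u` are all `1`-Lipschitz in the `L¹` norm of the test
  -- function, so convergence survives `L¹` limits.
  · refine isClosed_of_closure_subset fun f hf => ?_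
    refine Metric.tendsto_nhds.2 fun ε hε => ?_
    obtain ⟨g, hg, hfg⟩ := Metric.mem_closure_iff.1 hf (ε / 3) (by positivity)
    have hd : ∫ t, ‖f t - g t‖ ∂muI < ε / 3 := by
      rw [dist_eq_norm, L1.norm_eq_integral_norm] at hfg
      refine lt_of_eq_of_lt (integral_congr_ae ?_) hfg
      filter_upwards [Lp.coeFn_sub f g] with t ht
      rw [ht, Pi.sub_apply]
    have hfi := L1.integrable_coeFn f
    have hgi := L1.integrable_coeFn g
    filter_upwards [Metric.tendsto_nhds.1 hg (ε / 3) (by positivity)] with n hn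
    have h1 := abs_le.1 (abs_integral_inner_sub_le (hus n) hfi hgi)
    have h2 := abs_le.1 (abs_integral_inner_sub_le hu hfi hgi)
    rw [Real.dist_eq, abs_lt] at hn ⊢
    constructor <;> linarith [h1.1, h1.2, h2.1, h2.2, hn.1, hn.2]
  · have e : ∀ w : Linf, _ := fun w => integral_congr_ae (μ := muI)
      (hfg.mono fun t ht => congrArg (inner ℝ (w t)) ht)
    simpa only [e] using ih

end WeakStar

/-! ### Recovery sequences -/

section Construction

instance isProbabilityMeasure_muI : IsProbabilityMeasure muI := ⟨by simp⟩

theorem interval_mean_mem {V : Type*} [NormedAddCommGroup V] [NormedSpace ℝ V] [CompleteSpace V]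
    {s : Set V} (hs : Convex ℝ s) (hsc : IsClosed s) {f : ℝ → V} {a b : ℝ} (hab : a < b)
    (hf : IntegrableOn f (Ioc a b)) (hfs : ∀ᵐ t ∂(volume.restrict (Ioc a b)), f t ∈ s) :
    (b - a)⁻¹ • ∫ t in Ioc a b, f t ∈ s := by
  have h := hs.set_average_mem hsc (by simpa using hab) (by simp) hfs hf
  rwa [setAverage_eq, Real.volume_real_Ioc_of_le hab.le] at h

theorem aestronglyMeasurable_extendedFHom (hα : 0 ≤ α) (hKc : IsCompact K)
    (hK1 : ∀ w ∈ K, ‖w‖ ≤ 1) (u : Linf) :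
    AEStronglyMeasurable (fun t => extendedFHom K α (zeroExt u t)) volume :=
  ((lowerSemicontinuous_extendedFHom hα hKc hK1).measurable.comp_aemeasurable
    (integrable_zeroExt u).aestronglyMeasurable.aemeasurable).aestronglyMeasurable

theorem locallyIntegrable_extendedFHom (hα : 0 ≤ α) (hKc : IsCompact K)
    (hK1 : ∀ w ∈ K, ‖w‖ ≤ 1) (u : Linf) :
    LocallyIntegrable (fun t => extendedFHom K α (zeroExt u t)) :=
  (locallyIntegrable_const (α + 1)).mono (aestronglyMeasurable_extendedFHom hα hKc hK1 u)
    (Eventually.of_forall fun _ => (abs_extendedFHom_le hα hK1 _).trans (le_abs_self _))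

theorem ae_mk_extendedFHom_mem (hα : 0 ≤ α) (hK1 : ∀ w ∈ K, ‖w‖ ≤ 1) {u : Linf}
    (hu : ∀ᵐ t ∂muI, u t ∈ convexHull ℝ K) {a b : ℝ} (ha : 0 ≤ a) (hb : b ≤ 1) :
    ∀ᵐ t ∂(volume.restrict (Ioc a b)),
      (zeroExt u t, extendedFHom K α (zeroExt u t)) ∈ asymptoticSet (chainSums K α) := by
  refine (ae_restrict_iff' measurableSet_Ioc).2 ?_
  filter_upwards [(ae_restrict_iff' measurableSet_Ioo).1 hu, Measure.ae_ne volume (1 : ℝ)]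
    with t ht ht1 hmem
  have ht0 : t ∈ Ioo (0 : ℝ) 1 := ⟨lt_of_le_of_lt ha hmem.1,
    lt_of_le_of_ne (hmem.2.trans hb) ht1⟩
  rw [zeroExt, indicator_of_mem ht0, extendedFHom_of_mem (ht ht0)]
  exact mk_fHom_mem hα hK1 (ht ht0)

/-- Jensen's inequality in graph form: the pair of `u` and its energy density takes values in a
closed convex set, so its mean does too. -/
theorem interval_mean_mem_asymptoticSet (hα : 0 ≤ α) (hKc : IsCompact K)
    (hK1 : ∀ w ∈ K, ‖w‖ ≤ 1) {u : Linf} (hu : ∀ᵐ t ∂muI, u t ∈ convexHull ℝ K) {a b : ℝ}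
    (ha : 0 ≤ a) (hab : a < b) (hb : b ≤ 1) :
    ((b - a)⁻¹ • ∫ t in a..b, zeroExt u t,
      (b - a)⁻¹ * ∫ t in a..b, extendedFHom K α (zeroExt u t)) ∈
        asymptoticSet (chainSums K α) := by
  obtain ⟨t₀, ht₀⟩ := hu.exists
  have hT := isAlmostAdditive_chainSums hα (convexHull_nonempty_iff.1 ⟨_, ht₀⟩) hK1
  have hF : IntegrableOn (fun t => extendedFHom K α (zeroExt u t)) (Ioc a b) :=
    ((locallyIntegrable_extendedFHom hα hKc hK1 u).integrableOn_isCompact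
      isCompact_Icc).mono_set Ioc_subset_Icc_self
  have hU : IntegrableOn (zeroExt u) (Ioc a b) := (integrable_zeroExt u).integrableOn
  have havg := interval_mean_mem hT.convex_asymptoticSet isClosed_asymptoticSet hab
    (hU.prodMk hF) (ae_mk_extendedFHom_mem hα hK1 hu ha hb)
  rwa [integral_pair hU hF, ← intervalIntegral.integral_of_le hab.le,
    ← intervalIntegral.integral_of_le hab.le, Prod.smul_mk, smul_eq_mul] at havg

/-- Jensen's inequality on the cells of a partition of `I`. -/
theorem cellMean_mem_and_fHom_cellMean_le (hα : 0 ≤ α) (hKc : IsCompact K)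
    (hK1 : ∀ w ∈ K, ‖w‖ ≤ 1) {u : Linf} (hu : ∀ᵐ t ∂muI, u t ∈ convexHull ℝ K) {M j : ℕ}
    (hj : j < M) : cellMean (zeroExt u) M j ∈ convexHull ℝ K ∧
      fHom K α (cellMean (zeroExt u) M j) ≤
        (M : ℝ) * ∫ t in ((j : ℝ) / M)..((j + 1 : ℕ) / M), extendedFHom K α (zeroExt u t) := by
  have hM' : (0 : ℝ) < M := by exact_mod_cast (show 0 < M by omega)
  have hlt : (j : ℝ) / M < ((j + 1 : ℕ) : ℝ) / M := by gcongr; omega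
  have hlen : ((j + 1 : ℕ) : ℝ) / M - (j : ℝ) / M = (M : ℝ)⁻¹ := by
    push_cast; field_simp; ring
  have h1 : ((j + 1 : ℕ) : ℝ) / M ≤ 1 := by rw [div_le_one hM']; exact_mod_cast hj
  have havg := interval_mean_mem_asymptoticSet hα hKc hK1 hu
    (show 0 ≤ (j : ℝ) / M by positivity) hlt h1
  rw [hlen, inv_inv] at havg
  have h2 := fst_mem_convexHull hKc havg
  have h3 := fHom_le_of_mem hα hKc hK1 havg
  rw [cellMean]
  exact ⟨h2, h3⟩

theorem sum_integral_cells {V : Type*} [NormedAddCommGroup V] [NormedSpace ℝ V] {f : ℝ → V}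
    (hf : LocallyIntegrable f) (M j : ℕ) :
    ∑ i ∈ Finset.range j, ∫ t in ((i : ℝ) / M)..((i + 1 : ℕ) / M), f t =
      ∫ t in (0 : ℝ)..(j / M), f t := by
  have h := intervalIntegral.sum_integral_adjacent_intervals (f := f) (μ := volume)
    (a := fun i : ℕ => (i : ℝ) / M) (n := j) fun i _ =>
      (hf.integrableOn_isCompact isCompact_uIcc).intervalIntegrable
  simpa using h

theorem sum_fHom_cellMean_le (hα : 0 ≤ α) (hKc : IsCompact K) (hK1 : ∀ w ∈ K, ‖w‖ ≤ 1) {u : Linf}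
    (hu : ∀ᵐ t ∂muI, u t ∈ convexHull ℝ K) {M : ℕ} (hM : 0 < M) :
    (M : ℝ)⁻¹ * ∑ j ∈ Finset.range M, fHom K α (cellMean (zeroExt u) M j) ≤
      ∫ t, fHom K α (u t) ∂muI := by
  have hM' : (0 : ℝ) < M := by exact_mod_cast hM
  have hloc := locallyIntegrable_extendedFHom hα hKc hK1 u
  calc (M : ℝ)⁻¹ * ∑ j ∈ Finset.range M, fHom K α (cellMean (zeroExt u) M j)
      ≤ (M : ℝ)⁻¹ * ∑ j ∈ Finset.range M,
        (M : ℝ) * ∫ t in ((j : ℝ) / M)..((j + 1 : ℕ) / M), extendedFHom K α (zeroExt u t) := by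
        gcongr with j hj
        exact (cellMean_mem_and_fHom_cellMean_le hα hKc hK1 hu (Finset.mem_range.1 hj)).2
    _ = ∫ t in (0 : ℝ)..1, extendedFHom K α (zeroExt u t) := by
        rw [← Finset.mul_sum, sum_integral_cells hloc, inv_mul_cancel_left₀ hM'.ne',
          div_self hM'.ne']
    _ = ∫ t, fHom K α (u t) ∂muI := by
        rw [← integral_muI_eq]
        refine integral_congr_ae ?_
        filter_upwards [zeroExt_ae_eq u, hu] with t ht htc
        rw [ht, extendedFHom_of_mem htc]

/-- Concatenation of `M` given chains into an admissible chain on the lattice. -/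
theorem exists_chain_near (hα : 0 ≤ α) (hK1 : ∀ w ∈ K, ‖w‖ ≤ 1) {lam : ℝ} (hlam : 0 < lam)
    (hlam4 : lam ≤ 1 / 4) {M : ℕ} (hM : 0 < M) (hL : 0 < blockLen lam M) {w : ℕ → E3 × ℝ}
    (hw : ∀ j, ‖w j‖ ≤ α + 1) {U : ℕ → ℕ → E3} (hU : ∀ j i, U j i ∈ K)
    (hUw : ∀ j < M, ‖chainSum α (U j) (blockLen lam M) - (blockLen lam M : ℝ) • w j‖ ≤
      (M : ℝ)⁻¹ * blockLen lam M) :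
    ∃ v : ℕ → E3, (∀ i, v i ∈ K) ∧ v (⌊1 / lam⌋₊ - 1) = v 1 ∧ v ⌊1 / lam⌋₊ = v 0 ∧
      (∀ j ≤ M, ‖lam • chainSum α v (j * blockLen lam M) -
        (M : ℝ)⁻¹ • ∑ i ∈ Finset.range j, w i‖ ≤
          (M : ℝ)⁻¹ + (α + 1) * (M ^ 2 + 4 * M + 6) * lam) ∧
      lam * (chainSum α v (⌊1 / lam⌋₊ - 1)).2 ≤ (M : ℝ)⁻¹ * ∑ j ∈ Finset.range M, (w j).2 +
        (M : ℝ)⁻¹ + (α + 1) * (M ^ 2 + 5 * M + 7) * lam := by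
  have hM' : (0 : ℝ) < M := by exact_mod_cast hM
  have hα1 : 0 ≤ α + 1 := by linarith
  have hN : 4 ≤ ⌊1 / lam⌋₊ := Nat.le_floor (by rw [le_div_iff₀ hlam]; push_cast; linarith)
  have hMN := mul_blockLen_le_floor hlam hM
  have hML := mul_blockLen_le hlam hM
  have hNM := abs_floor_sub_mul_blockLen_le hlam (by linarith) hM
  have hLM := abs_mul_blockLen_sub_le hlam hM (j := 1) hM
  generalize ⌊1 / lam⌋₊ = N at *
  generalize blockLen lam M = L at *
  set v₀ : ℕ → E3 := fun i => U (i / L) (i % L) with hv₀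
  -- The last two spins copy `v₀ 1` and `v₀ 0`, so the final scalar product is the initial one with
  -- its factors exchanged.
  set v : ℕ → E3 := fun i => if i < N - 1 then v₀ i else if i = N - 1 then v₀ 1 else v₀ 0 with hv
  have hv₀K : ∀ i, v₀ i ∈ K := fun i => hU _ _
  have hvK : ∀ i, v i ∈ K := fun i => by
    simp only [hv]; split_ifs <;> exact hv₀K _
  have hv1 : ∀ i, ‖v i‖ ≤ 1 := fun i => hK1 _ (hvK i)
  have hv₀1 : ∀ i, ‖v₀ i‖ ≤ 1 := fun i => hK1 _ (hv₀K i)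
  have hagree : ∀ i < N - 1, v i = v₀ i := fun i hi => by simp only [hv, if_pos hi]
  -- `4 * (α + 1)` accounts for the energies that look past site `N - 2`; a further `2 * (α + 1)`
  -- for the term of site `N - 1` itself, present when `m = N`.
  have hend : ∀ m ≤ N, ‖chainSum α v m - chainSum α v₀ m‖ ≤ 6 * (α + 1) := fun m hm => by
    rcases Nat.lt_or_ge (N - 1) m with h | h
    · obtain rfl : m = N - 1 + 1 := by omega
      have h1 := norm_chainSum_sub_le hα hv1 hv₀1 hagree
      have h2 := norm_chainTerm_le hα hv1 (N - 1)
      have h3 := norm_chainTerm_le hα hv₀1 (N - 1)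
      have e : ∀ x : ℕ → E3, chainSum α x (N - 1 + 1) =
          chainSum α x (N - 1) + (x (N - 1), chainEnergy α x (N - 1)) :=
        fun x => Finset.sum_range_succ _ _
      rw [e, e, add_sub_add_comm]
      have h4 := norm_add_le (chainSum α v (N - 1) - chainSum α v₀ (N - 1))
        ((v (N - 1), chainEnergy α v (N - 1)) - (v₀ (N - 1), chainEnergy α v₀ (N - 1)))
      have h5 := norm_sub_le (v (N - 1), chainEnergy α v (N - 1))
        (v₀ (N - 1), chainEnergy α v₀ (N - 1))
      linarith
    · have := norm_chainSum_sub_le hα hv1 hv₀1 fun i hi => hagree i (lt_of_lt_of_le hi h)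
      linarith
  have hblock : ∀ j < M, ‖chainSum α (fun i => v₀ (j * L + i)) L - (L : ℝ) • w j‖ ≤
      4 * (α + 1) + (M : ℝ)⁻¹ * L := fun j hj => by
    have h1 := norm_chainSum_sub_le hα (fun i => hv₀1 (j * L + i)) (fun i => hK1 _ (hU j i))
      (m := L) fun i hi => by
        simp only [hv₀]
        rw [mul_comm j L, Nat.mul_add_div hL, Nat.div_eq_of_lt hi, Nat.mul_add_mod,
          Nat.mod_eq_of_lt hi, add_zero]
    have h2 := norm_add_le (chainSum α (fun i => v₀ (j * L + i)) L - chainSum α (U j) L)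
      (chainSum α (U j) L - (L : ℝ) • w j)
    rw [sub_add_sub_cancel] at h2
    linarith [hUw j hj]
  have hmain : ∀ j ≤ M, ‖lam • chainSum α v (j * L) - (M : ℝ)⁻¹ • ∑ i ∈ Finset.range j, w i‖ ≤
      (M : ℝ)⁻¹ + (α + 1) * (M ^ 2 + 4 * M + 6) * lam := fun j hj => by
    have hj' : (j : ℝ) ≤ M := by exact_mod_cast hj
    have h1 := hend (j * L) ((Nat.mul_le_mul_right L hj).trans hMN)
    have h2 : ‖chainSum α v₀ (j * L) - (L : ℝ) • ∑ i ∈ Finset.range j, w i‖ ≤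
        M * (4 * (α + 1) + (M : ℝ)⁻¹ * L) := by
      rw [chainSum_mul, Finset.smul_sum, ← Finset.sum_sub_distrib]
      refine (norm_sum_le_of_le _ fun i hi =>
        hblock i ((Finset.mem_range.1 hi).trans_le hj)).trans ?_
      rw [Finset.sum_const, Finset.card_range, nsmul_eq_mul]
      gcongr
    have h3 : ‖∑ i ∈ Finset.range j, w i‖ ≤ M * (α + 1) := by
      refine (norm_sum_le_of_le _ fun i _ => hw i).trans ?_
      rw [Finset.sum_const, Finset.card_range, nsmul_eq_mul]
      gcongr
    -- Three errors: the altered end (the `6`), the junctions and the block approximation (the `4 *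
    -- M` and the `M⁻¹`), and the mismatch between `lam * L` and `M⁻¹` (the `M ^ 2`).
    have e : lam • chainSum α v (j * L) - (M : ℝ)⁻¹ • ∑ i ∈ Finset.range j, w i =
        lam • (chainSum α v (j * L) - chainSum α v₀ (j * L)) +
        lam • (chainSum α v₀ (j * L) - (L : ℝ) • ∑ i ∈ Finset.range j, w i) +
        (lam * L - (M : ℝ)⁻¹) • ∑ i ∈ Finset.range j, w i := by module
    have hLM' : |lam * L - (M : ℝ)⁻¹| ≤ M * lam := by simpa using hLM
    have h4 : ‖lam • (chainSum α v (j * L) - chainSum α v₀ (j * L))‖ ≤ lam * (6 * (α + 1)) := by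
      rw [norm_smul, Real.norm_of_nonneg hlam.le]; gcongr
    have h5 : ‖lam • (chainSum α v₀ (j * L) - (L : ℝ) • ∑ i ∈ Finset.range j, w i)‖ ≤
        lam * (M * (4 * (α + 1) + (M : ℝ)⁻¹ * L)) := by
      rw [norm_smul, Real.norm_of_nonneg hlam.le]; gcongr
    have h6 : ‖(lam * L - (M : ℝ)⁻¹) • ∑ i ∈ Finset.range j, w i‖ ≤
        M * lam * (M * (α + 1)) := by
      rw [norm_smul, Real.norm_eq_abs]; gcongr
    have h7 : lam * (M * (4 * (α + 1) + (M : ℝ)⁻¹ * L)) =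
        lam * (4 * M * (α + 1)) + (M : ℝ)⁻¹ * (lam * (M * L)) := by ring
    have h8 : (M : ℝ)⁻¹ * (lam * (M * L)) ≤ (M : ℝ)⁻¹ * 1 := by gcongr
    rw [e]
    refine norm_add₃_le.trans ?_
    linarith
  refine ⟨v, hvK, ?_, ?_, hmain, ?_⟩
  · rw [hagree 1 (by omega)]
    simp [hv]
  · rw [hagree 0 (by omega)]
    simp only [hv]
    rw [if_neg (by omega), if_neg (by omega)]
  · have h1 := (abs_le.1 ((norm_snd_le _).trans (hmain M le_rfl))).2
    have h2 := (abs_le.1 ((norm_snd_le _).trans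
      (norm_chainSum_sub_chainSum_le hα hv1 (N - 1) (M * L)))).2
    -- Passing from `M * L` to `N - 1` energy terms adds `M + 1`, whence `5 * M + 7`.
    have h3 := mul_le_mul_of_nonneg_left hNM hα1
    simp only [Prod.snd_sub, Prod.smul_snd, smul_eq_mul, Prod.snd_sum] at h1 h2
    have h4 := mul_le_mul_of_nonneg_left (h2.trans h3) hlam.le
    linarith

end Construction

/-- The element of `L^∞(I; ℝ³)` that is represented by a lattice chain. -/
theorem exists_Linf_stepFun (lam : ℝ) {v : ℕ → E3} (hv : ∀ i, ‖v i‖ ≤ 1) :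
    ∃ w : Linf, w =ᵐ[muI] stepFun lam v ∧ (∀ᵐ t ∂muI, ‖w t‖ ≤ 1) ∧
      w =ᵐ[muI] pcExtension lam (fun i => v i.toNat) := by
  have hmem : MemLp (stepFun lam v) ⊤ muI :=
    memLp_top_of_bound (stronglyMeasurable_stepFun lam v).aestronglyMeasurable 1
      (Eventually.of_forall fun t => hv _)
  refine ⟨hmem.toLp _, hmem.coeFn_toLp, ?_, ?_⟩
  · filter_upwards [hmem.coeFn_toLp] with t ht
    rw [ht]; exact hv _
  · filter_upwards [hmem.coeFn_toLp] with t ht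
    rw [ht, stepFun, pcExtension, Int.floor_toNat]

theorem bulkEnergy_le {lam : ℝ} (hlam : 0 < lam) (hlam4 : lam ≤ 1 / 4) {v : ℕ → E3}
    (hv : ∀ i, v i ∈ K) (h1 : v (⌊1 / lam⌋₊ - 1) = v 1) (h0 : v ⌊1 / lam⌋₊ = v 0) {w : Linf}
    (hw : w =ᵐ[muI] pcExtension lam (fun i => v i.toNat)) :
    bulkEnergy K α lam w ≤ ((lam * (chainSum α v (⌊1 / lam⌋₊ - 1)).2 : ℝ) : EReal) := by
  have hadm : (fun i : ℤ => v i.toNat) ∈ {x : ℤ → E3 | IsAdmissible K lam x ∧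
      w =ᵐ[muI] pcExtension lam x} := by
    refine ⟨⟨fun i _ => hv _, ?_⟩, hw⟩
    have e : (⌊1 / lam⌋ - 1).toNat = ⌊1 / lam⌋₊ - 1 := by
      rw [← natCast_floor_inv hlam]; omega
    have e' : ⌊1 / lam⌋.toNat = ⌊1 / lam⌋₊ := Int.floor_toNat _
    simp only [e, e', h1, h0, Int.toNat_zero, Int.toNat_one]
    exact real_inner_comm _ _
  refine (iInf₂_le _ hadm).trans_eq ?_
  rw [latticeEnergy_eq (w := v) hlam (by linarith) fun i _ => by simp]

/-- Primitives of functions bounded by `1` are `1`-Lipschitz, and `t` is within `M⁻¹` of a grid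
point `j / M`, itself within `M * lam` of the end of the `j`-th block. -/
theorem norm_primitive_sub_le {lam : ℝ} (hlam : 0 < lam) {M : ℕ} (hM : 0 < M) {w u : Linf}
    (hw : ∀ᵐ t ∂muI, ‖w t‖ ≤ 1) (hu : ∀ᵐ t ∂muI, ‖u t‖ ≤ 1) {η : ℝ}
    (h : ∀ j ≤ M, ‖(∫ t in (0 : ℝ)..(lam * ((j * blockLen lam M : ℕ) : ℝ)), zeroExt w t) -
      ∫ t in (0 : ℝ)..(j / M), zeroExt u t‖ ≤ η) {t : ℝ} (ht : t ∈ Icc (0 : ℝ) 1) :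
    ‖(∫ s in (0 : ℝ)..t, zeroExt w s) - ∫ s in (0 : ℝ)..t, zeroExt u s‖ ≤
      η + 2 * (M : ℝ)⁻¹ + M * lam := by
  have hM' : (0 : ℝ) < M := by exact_mod_cast hM
  have hj : ⌊t * M⌋₊ ≤ M := Nat.floor_le_of_le (by nlinarith [ht.2])
  have hf1 := Nat.floor_le (show 0 ≤ t * M by have := ht.1; positivity)
  have hf2 := Nat.lt_floor_add_one (t * (M : ℝ))
  generalize ⌊t * M⌋₊ = j at *
  have hjt : |t - j / M| ≤ (M : ℝ)⁻¹ := by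
    have e : t - j / M = (t * M - j) * (M : ℝ)⁻¹ := by field_simp
    rw [e, abs_mul, abs_of_pos (inv_pos.2 hM')]
    refine mul_le_of_le_one_left (by positivity) ?_
    rw [abs_le]; constructor <;> linarith
  have hjl := abs_mul_blockLen_sub_le hlam hM hj
  have split : ∀ (x : Linf) (a : ℝ), ∫ s in (0 : ℝ)..t, zeroExt x s =
      (∫ s in (0 : ℝ)..a, zeroExt x s) + ∫ s in a..t, zeroExt x s := fun x a =>
    (intervalIntegral.integral_add_adjacent_intervals (intervalIntegrable_zeroExt _ _ _)
      (intervalIntegrable_zeroExt _ _ _)).symm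
  have h1 := norm_integral_zeroExt_le zero_le_one hw (lam * ((j * blockLen lam M : ℕ) : ℝ)) t
  have h2 := norm_integral_zeroExt_le zero_le_one hu ((j : ℝ) / M) t
  have h3 : |t - lam * ((j * blockLen lam M : ℕ) : ℝ)| ≤ (M : ℝ)⁻¹ + M * lam := by
    have := abs_sub_le t (j / M) (lam * ((j * blockLen lam M : ℕ) : ℝ))
    rw [abs_sub_comm ((j : ℝ) / M)] at this
    linarith
  rw [split w (lam * ((j * blockLen lam M : ℕ) : ℝ)), split u ((j : ℝ) / M), add_sub_add_comm]
  have h4 := norm_add_le ((∫ s in (0 : ℝ)..(lam * ((j * blockLen lam M : ℕ) : ℝ)), zeroExt w s) -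
      ∫ s in (0 : ℝ)..(j / M), zeroExt u s)
    ((∫ s in (lam * ((j * blockLen lam M : ℕ) : ℝ))..t, zeroExt w s) -
      ∫ s in (j / M : ℝ)..t, zeroExt u s)
  have h5 := norm_sub_le (∫ s in (lam * ((j * blockLen lam M : ℕ) : ℝ))..t, zeroExt w s)
    (∫ s in (j / M : ℝ)..t, zeroExt u s)
  have h6 := h j hj
  linarith

theorem convexHull_norm_le (hK1 : ∀ w ∈ K, ‖w‖ ≤ 1) {z : E3} (hz : z ∈ convexHull ℝ K) :
    ‖z‖ ≤ 1 := by
  have := convexHull_min (fun w hw => by simpa using hK1 w hw) (convex_closedBall (0 : E3) 1) hz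
  simpa using this

/-- For fixed `M`, chains are chosen near the points of the asymptotic set above the cell means.
Once `n` is large every lattice error is at most `M⁻¹`: the primitives accumulate five such errors,
the energy only two. -/
theorem eventually_exists_approx (hα : 0 ≤ α) (hKc : IsCompact K) (hK1 : ∀ w ∈ K, ‖w‖ ≤ 1)
    {lam : ℕ → ℝ} (hpos : ∀ n, 0 < lam n) (hlam : Tendsto lam atTop (𝓝 0)) {u : Linf}
    (hu : ∀ᵐ t ∂muI, u t ∈ convexHull ℝ K) {M : ℕ} (hM : 0 < M) :
    ∀ᶠ n in atTop, ∃ w : Linf, (∀ᵐ t ∂muI, ‖w t‖ ≤ 1) ∧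
      (∀ t ∈ Icc (0 : ℝ) 1, ‖(∫ s in (0 : ℝ)..t, zeroExt w s) -
        ∫ s in (0 : ℝ)..t, zeroExt u s‖ ≤ 5 * (M : ℝ)⁻¹) ∧
      bulkEnergy K α (lam n) w ≤
        ((∫ t, fHom K α (u t) ∂muI + 5 * (M : ℝ)⁻¹ : ℝ) : EReal) := by
  have hM' : (0 : ℝ) < M := by exact_mod_cast hM
  obtain ⟨t₀, ht₀⟩ := hu.exists
  have hK : K.Nonempty := convexHull_nonempty_iff.1 ⟨_, ht₀⟩
  have hT := isAlmostAdditive_chainSums hα hK hK1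
  set z : ℕ → E3 := cellMean (zeroExt u) M with hz
  have hzK : ∀ j < M, z j ∈ convexHull ℝ K := fun j hj =>
    (cellMean_mem_and_fHom_cellMean_le hα hKc hK1 hu hj).1
  set w : ℕ → E3 × ℝ := fun j => if j < M then (z j, fHom K α (z j)) else 0 with hw
  have hwj : ∀ j < M, w j = (z j, fHom K α (z j)) := fun j hj => if_pos hj
  have hw1 : ∀ j, ‖w j‖ ≤ α + 1 := fun j => by
    by_cases hj : j < M
    · rw [hwj j hj]
      exact hT.norm_le_of_mem_asymptoticSet (mk_fHom_mem hα hK1 (hzK j hj))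
    · simp only [hw, if_neg hj, norm_zero]
      linarith
  have hev : ∀ᶠ L : ℕ in atTop, ∀ j ∈ Finset.range M, ∃ x ∈ chainSums K α L,
      ‖x - (L : ℝ) • w j‖ ≤ (M : ℝ)⁻¹ * L := by
    rw [Filter.eventually_all_finset]
    intro j hj
    have hj' := Finset.mem_range.1 hj
    rw [hwj j hj']
    exact mk_fHom_mem hα hK1 (hzK j hj') _ (inv_pos.2 hM')
  have hL := tendsto_blockLen hpos hlam hM
  have hsmall : Tendsto (fun n => (α + 1) * (M ^ 2 + 5 * M + 7) * lam n) atTop (𝓝 0) := by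
    simpa using hlam.const_mul ((α + 1) * ((M : ℝ) ^ 2 + 5 * M + 7))
  filter_upwards [hL.eventually hev, hL.eventually_gt_atTop 0,
    hlam.eventually_le_const (show (0 : ℝ) < 1 / 4 by norm_num),
    hsmall.eventually_le_const (inv_pos.2 hM')] with n hn hn0 hn4 hns
  have hex : ∀ j, ∃ U : ℕ → E3, (∀ i, U i ∈ K) ∧ (j < M →
      ‖chainSum α U (blockLen (lam n) M) - (blockLen (lam n) M : ℝ) • w j‖ ≤
        (M : ℝ)⁻¹ * blockLen (lam n) M) := fun j => by
    by_cases hj : j < M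
    · obtain ⟨_, ⟨U, hU, rfl⟩, hx⟩ := hn j (Finset.mem_range.2 hj)
      exact ⟨U, hU, fun _ => hx⟩
    · exact ⟨fun _ => hK.some, fun _ => hK.some_mem, fun h => absurd h hj⟩
  choose U hUK hU using hex
  obtain ⟨v, hvK, hv1, hv0, hvb, hve⟩ :=
    exists_chain_near hα hK1 (hpos n) hn4 hM hn0 hw1 hUK hU
  obtain ⟨x, hxs, hx1, hxp⟩ := exists_Linf_stepFun (lam n) fun i => hK1 _ (hvK i)
  have hlamn := hpos n
  have hα1 : 0 ≤ α + 1 := by linarith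
  have hterm1 : (α + 1) * ((M : ℝ) ^ 2 + 4 * M + 6) * lam n ≤ (M : ℝ)⁻¹ :=
    le_trans (by gcongr <;> linarith) hns
  have hterm2 : M * lam n ≤ (M : ℝ)⁻¹ := by
    refine le_trans (mul_le_mul_of_nonneg_right ?_ hlamn.le) hns
    nlinarith
  refine ⟨x, hx1, fun t ht => ?_, ?_⟩
  · have hprim : ∀ j ≤ M, ‖(∫ t in (0 : ℝ)..(lam n * ((j * blockLen (lam n) M : ℕ) : ℝ)),
        zeroExt x t) - ∫ t in (0 : ℝ)..(j / M), zeroExt u t‖ ≤ 2 * (M : ℝ)⁻¹ := fun j hj => by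
      have hle : lam n * ((j * blockLen (lam n) M : ℕ) : ℝ) ≤ 1 := by
        have h2 := mul_blockLen_le hlamn hM
        have h3 : (j : ℝ) ≤ M := by exact_mod_cast hj
        push_cast
        refine le_trans ?_ h2
        gcongr
      rw [integral_zeroExt_of_stepFun hlamn hxs hle,
        ← sum_integral_cells (integrable_zeroExt u).locallyIntegrable M j]
      have e : ∑ i ∈ Finset.range j, ∫ t in ((i : ℝ) / M)..((i + 1 : ℕ) / M), zeroExt u t =
          ((M : ℝ)⁻¹ • ∑ i ∈ Finset.range j, w i).1 := by
        rw [Prod.smul_fst, Prod.fst_sum, Finset.smul_sum]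
        refine Finset.sum_congr rfl fun i hi => ?_
        rw [hwj i ((Finset.mem_range.1 hi).trans_le hj), hz, cellMean, inv_smul_smul₀ hM'.ne']
      rw [e, ← chainSum_fst (α := α), ← Prod.smul_fst, ← Prod.fst_sub]
      refine (norm_fst_le _).trans ((hvb j hj).trans ?_)
      linarith
    have hu1 : ∀ᵐ t ∂muI, ‖u t‖ ≤ 1 := hu.mono fun t ht => convexHull_norm_le hK1 ht
    have := norm_primitive_sub_le hlamn hM hx1 hu1 hprim ht
    linarith
  · refine (bulkEnergy_le hlamn hn4 hvK hv1 hv0 hxp).trans (EReal.coe_le_coe_iff.2 ?_)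
    have h1 := sum_fHom_cellMean_le hα hKc hK1 hu hM
    rw [Finset.sum_congr rfl fun j hj => by rw [hwj j (Finset.mem_range.1 hj)]] at hve
    have h2 := inv_pos.2 hM'
    linarith

/-- A diagonal sequence. -/
theorem exists_tendsto_eventually {P : ℕ → ℕ → Prop} (h : ∀ M, 0 < M → ∀ᶠ n in atTop, P M n) :
    ∃ m : ℕ → ℕ, Tendsto m atTop atTop ∧ ∀ᶠ n in atTop, P (m n) n := by
  classical
  -- Take the largest `M ≤ n` for which `P M n` holds; each fixed `M` is eventually available, so
  -- this tends to infinity.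
  refine ⟨fun n => Nat.findGreatest (fun M => P M n) n, tendsto_atTop.2 fun b => ?_, ?_⟩
  · filter_upwards [h (b + 1) (Nat.succ_pos b), eventually_ge_atTop (b + 1)] with n hn hb
    exact (Nat.le_succ b).trans (Nat.le_findGreatest hb hn)
  · filter_upwards [h 1 one_pos, eventually_ge_atTop 1] with n hn hb
    exact Nat.findGreatest_spec (P := fun M => P M n) hb hn

theorem exists_recovery (hα : 0 ≤ α) (hKc : IsCompact K) (hK1 : ∀ w ∈ K, ‖w‖ ≤ 1)
    {lam : ℕ → ℝ} (hpos : ∀ n, 0 < lam n) (hlam : Tendsto lam atTop (𝓝 0)) (u : Linf) :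
    ∃ us : ℕ → Linf, WeakStarTendsto us u ∧
      limsup (fun n => bulkEnergy K α (lam n) (us n)) atTop ≤ limitEnergy K α u := by
  by_cases hu : ∀ᵐ t ∂muI, u t ∈ convexHull ℝ K
  swap
  · refine ⟨fun _ => u, fun g _ => tendsto_const_nhds, ?_⟩
    rw [limitEnergy, if_neg hu]
    exact le_top
  obtain ⟨m, hm, hev⟩ := exists_tendsto_eventually
    fun M hM => eventually_exists_approx hα hKc hK1 hpos hlam hu (M := M) hM
  have hu1 : ∀ᵐ t ∂muI, ‖u t‖ ≤ 1 := hu.mono fun t ht => convexHull_norm_le hK1 ht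
  have hex : ∀ n, ∃ w : Linf, (∀ᵐ t ∂muI, ‖w t‖ ≤ 1) ∧ ((∃ w : Linf, (∀ᵐ t ∂muI, ‖w t‖ ≤ 1) ∧
      (∀ t ∈ Icc (0 : ℝ) 1, ‖(∫ s in (0 : ℝ)..t, zeroExt w s) -
        ∫ s in (0 : ℝ)..t, zeroExt u s‖ ≤ 5 * (m n : ℝ)⁻¹) ∧
      bulkEnergy K α (lam n) w ≤
        ((∫ t, fHom K α (u t) ∂muI + 5 * (m n : ℝ)⁻¹ : ℝ) : EReal)) →
      (∀ t ∈ Icc (0 : ℝ) 1, ‖(∫ s in (0 : ℝ)..t, zeroExt w s) -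
        ∫ s in (0 : ℝ)..t, zeroExt u s‖ ≤ 5 * (m n : ℝ)⁻¹) ∧
      bulkEnergy K α (lam n) w ≤
        ((∫ t, fHom K α (u t) ∂muI + 5 * (m n : ℝ)⁻¹ : ℝ) : EReal)) := fun n => by
    by_cases h : ∃ w : Linf, (∀ᵐ t ∂muI, ‖w t‖ ≤ 1) ∧
      (∀ t ∈ Icc (0 : ℝ) 1, ‖(∫ s in (0 : ℝ)..t, zeroExt w s) -
        ∫ s in (0 : ℝ)..t, zeroExt u s‖ ≤ 5 * (m n : ℝ)⁻¹) ∧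
      bulkEnergy K α (lam n) w ≤
        ((∫ t, fHom K α (u t) ∂muI + 5 * (m n : ℝ)⁻¹ : ℝ) : EReal)
    · obtain ⟨w, hw1, hw⟩ := h
      exact ⟨w, hw1, fun _ => hw⟩
    -- The default `u` keeps the bound by `1` for every `n`, as `weakStarTendsto_of_primitive`
    -- requires.
    · exact ⟨u, hu1, fun h' => absurd h' h⟩
  choose us hus1 hus using hex
  have hgood := hev.mono fun n hn => hus n hn
  have h0 : Tendsto (fun n => 5 * (m n : ℝ)⁻¹) atTop (𝓝 0) := by
    have : Tendsto (fun n => (m n : ℝ)⁻¹) atTop (𝓝 0) :=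
      tendsto_inv_atTop_nhds_zero_nat.comp hm
    simpa using this.const_mul 5
  refine ⟨us, weakStarTendsto_of_primitive hus1 hu1 fun t ht => ?_, ?_⟩
  · refine tendsto_iff_norm_sub_tendsto_zero.2 (squeeze_zero' (Eventually.of_forall fun _ =>
      norm_nonneg _) (hgood.mono fun n hn => hn.1 t ht) h0)
  · rw [limitEnergy, if_pos hu]
    have hlim : Tendsto (fun n => ((∫ t, fHom K α (u t) ∂muI + 5 * (m n : ℝ)⁻¹ : ℝ) : EReal))
        atTop (𝓝 ((∫ t, fHom K α (u t) ∂muI : ℝ) : EReal)) := by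
      refine (continuous_coe_real_ereal.tendsto _).comp ?_
      simpa using h0.const_add (∫ t, fHom K α (u t) ∂muI)
    rw [← hlim.limsup_eq]
    exact limsup_le_limsup (hgood.mono fun n hn => hn.2)

/-! ### Compactness of the circumferences and conclusion -/

theorem isCompact_circumference {v : E3} {R : ℝ} (hR : R < 1) :
    IsCompact (circumference v R) := by
  have e : circumference v R = {w | ‖w‖ = 1} ∩
      {w | ‖((Submodule.span ℝ {v})ᗮ).starProjection w‖ = R} ∩ {w | 0 ≤ inner ℝ w v} := by
    ext w
    constructor
    · rintro ⟨h1, h2, h3⟩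
      exact ⟨⟨h1, h2⟩, h3.le⟩
    · rintro ⟨⟨h1, h2⟩, h3⟩
      -- The strict inequality may be relaxed to a closed condition: if `w` were orthogonal to `v`,
      -- its projection would be `w` itself, of norm `1 ≠ R`.
      refine ⟨h1, h2, lt_of_le_of_ne h3 fun h => hR.ne ?_⟩
      have hmem : w ∈ (Submodule.span ℝ {v})ᗮ :=
        Submodule.mem_orthogonal_singleton_iff_inner_left.2 h.symm
      have h2' : ‖((Submodule.span ℝ {v})ᗮ).starProjection w‖ = R := h2
      rw [Submodule.starProjection_eq_self_iff.2 hmem] at h2'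
      exact h2'.symm.trans h1
  rw [e]
  refine (isCompact_closedBall (0 : E3) 1).of_isClosed_subset ?_ fun w hw => by
    have : ‖w‖ = 1 := hw.1.1
    simp [this]
  exact ((isClosed_eq continuous_norm continuous_const).inter
    (isClosed_eq (by fun_prop) continuous_const)).inter (isClosed_le continuous_const (by fun_prop))

end SpinChain

end

theorem mainTheorem5 (v₁ v₂ : SpinChain.E3) (hv₁ : ‖v₁‖ = 1) (hv₂ : ‖v₂‖ = 1)
    (R : ℝ) (hR_pos : 0 < R) (hR_lt : R < Real.sqrt ((1 - inner ℝ v₁ v₂) / 2))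
    (α : ℝ) (hα : 0 < α)
    (lam : ℕ → ℝ) (hlam_pos : ∀ n, 0 < lam n) (hlam : Tendsto lam atTop (𝓝 0))
    (K : Set SpinChain.E3)
    (hK : K = SpinChain.circumference v₁ R ∪ SpinChain.circumference v₂ R) :
    (∀ z ∈ convexHull ℝ K, SpinChain.HomFormulaHolds K α z) ∧
    (∀ u : SpinChain.Linf, (∀ᵐ t ∂SpinChain.muI, u t ∈ convexHull ℝ K) →
      Integrable (fun t => SpinChain.fHom K α (u t)) SpinChain.muI) ∧
    SpinChain.GammaConverges (fun n => SpinChain.bulkEnergy K α (lam n))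
      (SpinChain.limitEnergy K α) := by
  -- By Cauchy–Schwarz `v₁ · v₂ ≥ -1`, so the quantity under the root is at most `1`.
  have hR1 : R < 1 := by
    refine hR_lt.trans_le (Real.sqrt_le_one.2 ?_)
    have := (abs_le.1 (abs_real_inner_le_norm v₁ v₂)).1
    rw [hv₁, hv₂] at this
    linarith
  have hKc : IsCompact K := hK ▸ (SpinChain.isCompact_circumference hR1).union
    (SpinChain.isCompact_circumference hR1)
  have hK1 : ∀ w ∈ K, ‖w‖ ≤ 1 := by
    rw [hK]
    rintro w (hw | hw) <;> exact hw.1.le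
  exact ⟨fun z hz => SpinChain.homFormulaHolds hα.le hK1 hz,
    fun u hu => SpinChain.integrable_fHom_comp hα.le hKc hK1 hu,
    ⟨fun u us h => SpinChain.limitEnergy_le_liminf hα.le hKc hK1 hlam_pos hlam h,
      fun u => SpinChain.exists_recovery hα.le hKc hK1 hlam_pos hlam u⟩⟩
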